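/- Consider a networked system of $N$ linear time-invariant subsystems with real constant matrices, $\dot x_i=A_ix_i+B_ir_i+U_iv_i+X_ia_i$, $y_i=C_ix_i+D_ir_i+V_iv_i+Y_ia_i$, $w_i=E_ix_i+F_ir_i+W_iv_i+Z_ia_i$ ($i=1,\dots,N$; $x_i$ state, $r_i$ reference, $v_i$ and $w_i$ inflowing and outflowing interaction, $a_i$ attack, $y_i$ measurement), with zero initial state. Let $G_{y_ia_i},G_{y_iv_i},G_{w_ia_i},G_{w_iv_i}$ be the transfer matrices of the $i$th subsystem between the indicated signals. Let $L$ be a proper real rational transfer matrix; when the subsystems in $\mathcal I\subset\{1,\dots,N\}$ remain, they are interconnected by $v_{\mathcal I}=L_{\mathcal I}w_{\mathcal I}$, where $L_{\mathcal I}$ consists of the blocks $(i,j)$ of $L$ with $i,j\in\mathcal I$; call this network $\Sigma_{\mathcal I}$. Let $\mathfrak I$ be a family of subsets of $\{1,\dots,N\}$ such that, for every $\mathcal I\in\mathfrak I$, $\Sigma_{\mathcal I}$ is well-posed and internally stable and has no undetectable attack, i.e. no attack $a_{\mathcal I}\ne0$ for which the outputs $y_{\mathcal I}$ with and without the attack coincide.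 Put $Q_{\mathcal I}=L_{\mathcal I}(I-\mathrm{diag}(G_{w_iv_i})_{i\in\mathcal I}L_{\mathcal I})^{-1}$. Let $H_i$ be gains such that $A_i-H_iC_i$ is Hurwitz for $i=1,\dots,N$, and, for the remaining set $\mathcal I$, use the distributed residual generator with zero initial state $$\dot{\hat x}_i=A_i\hat x_i+B_ir_i+U_i\hat v_i+\mu_i,\quad \hat y_i=C_i\hat x_i+D_ir_i+V_i\hat v_i,\quad \hat w_i=E_i\hat x_i+F_ir_i+W_i\hat v_i-E_i\hat\chi_i,$$ $$\dot{\hat\chi}_i=A_i\hat\chi_i+\mu_i,\quad \mu_i=H_i(y_i-\hat y_i),\quad \epsilon_i=S_i(y_i-\hat y_i)\qquad(i\in\mathcal I),\qquad \hat v_{\mathcal I}=L_{\mathcal I}\hat w_{\mathcal I},$$ where $S_i$ is a stable real rational transfer matrix. Say that $S_i$ isolates $a_i$ in $\Sigma_{\mathcal I}$, $i\in\mathcal I$, if $\epsilon_i\neq0\Leftrightarrow a_i\neq0$ for all references $r_{\mathcal I}$ and all attacks $a_{\mathcal I}$. All signals are locally integrable functions on $[0,\infty)$, identified when equal almost everywhere,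 and $\mathrm{rank}$ of a transfer matrix is its normal rank, i.e. its rank over the field of rational functions. Let $i\in\{1,\dots,N\}$. (a) If $$\mathrm{rank}\,[\,G_{y_ia_i}\ \ G_{y_iv_i}\,]=\dim(a_i)+\mathrm{rank}\,G_{y_iv_i},\qquad(*)$$ then there is a stable filter $S_i$, not depending on $\mathcal I$, that isolates $a_i$ in $\Sigma_{\mathcal I}$ for every $\mathcal I\in\mathfrak I$ with $i\in\mathcal I$. The condition $(*)$ does not depend on $\mathcal I$. (b) Let $i\in\mathcal I\in\mathfrak I$, and suppose that the transfer matrix $T_{v_ia_{-i}}$, which consists of the rows of $Q_{\mathcal I}\,\mathrm{diag}(G_{w_ja_j})_{j\in\mathcal I}$ belonging to $v_i$ and its columns belonging to the attacks $a_j$, $j\in\mathcal I\setminus\{i\}$, is right invertible over the real rational functions. If some stable filter $S_i$ isolates $a_i$ in $\Sigma_{\mathcal I}$, then $(*)$ holds. -/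

import Mathlib

open MeasureTheory Filter Topology

/-! ### Signals on the time axis `[0, ∞)` -/

/-- Lebesgue measure on the time axis `[0, ∞)`. -/
noncomputable def timeMeasure : Measure ℝ := volume.restrict (Set.Ici (0 : ℝ))

/-- An admissible signal: a locally integrable function on `[0, ∞)`; values at negative
times are irrelevant, and signals are identified when they agree almost everywhere. -/
def IsSignal {m : Type*} [Fintype m] (u : ℝ → m → ℝ) : Prop :=
  LocallyIntegrableOn u (Set.Ici (0 : ℝ)) volume

/-- The signal `u` vanishes (almost everywhere on `[0, ∞)`). -/
def IsZeroSignal {m : Type*} (u : ℝ → m → ℝ) : Prop :=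
  ∀ᵐ t ∂timeMeasure, u t = 0

/-- `x` is the (Carathéodory) solution of `ẋ = A x + f` with `x(0) = 0` on `[0, ∞)`. -/
def IsStateTrajectory {n : Type*} [Fintype n] (A : Matrix n n ℝ) (f x : ℝ → n → ℝ) : Prop :=
  ContinuousOn x (Set.Ici (0 : ℝ)) ∧
    ∀ t : ℝ, 0 ≤ t → x t = ∫ s in (0 : ℝ)..t, (A.mulVec (x s) + f s)

/-- All eigenvalues of the real matrix `A` have negative real part. -/
def IsHurwitz {n : Type*} [Fintype n] [DecidableEq n] (A : Matrix n n ℝ) : Prop :=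
  ∀ z ∈ spectrum ℂ (A.map (algebraMap ℝ ℂ)), z.re < 0

/-! ### Real rational transfer matrices

The normal rank of a transfer matrix is its rank over the field of rational functions. -/

/-- Every entry is a proper rational function. -/
def IsProper {p m : Type*} (G : Matrix p m (RatFunc ℝ)) : Prop :=
  ∀ i j, (G i j).num.degree ≤ (G i j).denom.degree

/-- `G` belongs to `RH∞`: it is proper, and all poles of its entries lie in the open left
half plane. -/
def IsStableTransfer {p m : Type*} (G : Matrix p m (RatFunc ℝ)) : Prop :=
  IsProper G ∧ ∀ i j, ∀ z : ℂ, Polynomial.aeval z (G i j).denom = 0 → z.re < 0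

/-- Right invertibility over the field of real rational functions. -/
def IsRightInvertible {p m : Type*} [Fintype m] [DecidableEq p]
    (G : Matrix p m (RatFunc ℝ)) : Prop :=
  ∃ R : Matrix m p (RatFunc ℝ), G * R = 1

/-- The transfer matrix `C (s I - A)⁻¹ B + D`. -/
noncomputable def transferMatrix {n m p : Type*} [Fintype n] [DecidableEq n]
    (A : Matrix n n ℝ) (B : Matrix n m ℝ) (C : Matrix p n ℝ) (D : Matrix p m ℝ) :
    Matrix p m (RatFunc ℝ) :=
  C.map RatFunc.C * (Matrix.scalar n RatFunc.X - A.map RatFunc.C)⁻¹ * B.map RatFunc.C +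
    D.map RatFunc.C

/-- A finite-dimensional real state-space system with inputs `m` and outputs `p`. -/
structure StateSpace (m p : Type*) where
  order : ℕ
  A : Matrix (Fin order) (Fin order) ℝ
  B : Matrix (Fin order) m ℝ
  C : Matrix p (Fin order) ℝ
  D : Matrix p m ℝ

/-- The transfer matrix of a state-space system. -/
noncomputable def StateSpace.transfer {m p : Type*} (K : StateSpace m p) :
    Matrix p m (RatFunc ℝ) :=
  transferMatrix K.A K.B K.C K.D

/-- In the time domain, `y` is the response of the transfer matrix `G` to the input `u`: it is
the output, from the zero initial state, of a state-space realization of `G`.  (The response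
does not depend on the realization.) -/
def IsResponse {m p : Type*} [Fintype m] (G : Matrix p m (RatFunc ℝ))
    (u : ℝ → m → ℝ) (y : ℝ → p → ℝ) : Prop :=
  IsSignal u ∧ ∃ K : StateSpace m p, K.transfer = G ∧
    ∃ x : ℝ → Fin K.order → ℝ,
      IsStateTrajectory K.A (fun t => K.B.mulVec (u t)) x ∧
      ∀ᵐ t ∂timeMeasure, y t = K.C.mulVec (x t) + K.D.mulVec (u t)

/-- Stack the signals `u i` into a single signal. -/
def stack {ι : Type*} {d : ι → ℕ} (u : ∀ i, ℝ → Fin (d i) → ℝ) :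
    ℝ → (Σ i, Fin (d i)) → ℝ :=
  fun t q => u q.1 t q.2

/-! ### The networked system -/

/-- A networked system with `N` subsystems
`ẋᵢ = Aᵢ xᵢ + Bᵢ rᵢ + Uᵢ vᵢ + Xᵢ aᵢ`, `yᵢ = Cᵢ xᵢ + Dᵢ rᵢ + Vᵢ vᵢ + Yᵢ aᵢ`,
`wᵢ = Eᵢ xᵢ + Fᵢ rᵢ + Wᵢ vᵢ + Zᵢ aᵢ`, interconnected by `v = L w` with a proper
transfer matrix `L`. -/
structure NetworkedSystem (N : ℕ) where
  nx : Fin N → ℕ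
  nr : Fin N → ℕ
  ny : Fin N → ℕ
  nv : Fin N → ℕ
  nw : Fin N → ℕ
  na : Fin N → ℕ
  A : ∀ i, Matrix (Fin (nx i)) (Fin (nx i)) ℝ
  B : ∀ i, Matrix (Fin (nx i)) (Fin (nr i)) ℝ
  U : ∀ i, Matrix (Fin (nx i)) (Fin (nv i)) ℝ
  X : ∀ i, Matrix (Fin (nx i)) (Fin (na i)) ℝ
  C : ∀ i, Matrix (Fin (ny i)) (Fin (nx i)) ℝ
  D : ∀ i, Matrix (Fin (ny i)) (Fin (nr i)) ℝ
  V : ∀ i, Matrix (Fin (ny i)) (Fin (nv i)) ℝ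
  Y : ∀ i, Matrix (Fin (ny i)) (Fin (na i)) ℝ
  E : ∀ i, Matrix (Fin (nw i)) (Fin (nx i)) ℝ
  F : ∀ i, Matrix (Fin (nw i)) (Fin (nr i)) ℝ
  W : ∀ i, Matrix (Fin (nw i)) (Fin (nv i)) ℝ
  Z : ∀ i, Matrix (Fin (nw i)) (Fin (na i)) ℝ
  L : Matrix (Σ i, Fin (nv i)) (Σ i, Fin (nw i)) (RatFunc ℝ)
  L_proper : IsProper L

namespace NetworkedSystem

variable {N : ℕ} (P : NetworkedSystem N)

/-- `G_{y_i a_i}`. -/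
noncomputable def Gya (i : Fin N) : Matrix (Fin (P.ny i)) (Fin (P.na i)) (RatFunc ℝ) :=
  transferMatrix (P.A i) (P.X i) (P.C i) (P.Y i)

/-- `G_{y_i v_i}`. -/
noncomputable def Gyv (i : Fin N) : Matrix (Fin (P.ny i)) (Fin (P.nv i)) (RatFunc ℝ) :=
  transferMatrix (P.A i) (P.U i) (P.C i) (P.V i)

/-- `G_{w_i a_i}`. -/
noncomputable def Gwa (i : Fin N) : Matrix (Fin (P.nw i)) (Fin (P.na i)) (RatFunc ℝ) :=
  transferMatrix (P.A i) (P.X i) (P.E i) (P.Z i)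

/-- `G_{w_i v_i}`. -/
noncomputable def Gwv (i : Fin N) : Matrix (Fin (P.nw i)) (Fin (P.nv i)) (RatFunc ℝ) :=
  transferMatrix (P.A i) (P.U i) (P.E i) (P.W i)

/-- `L_I`: the submatrix of the blocks `(i, j)` of `L` with `i, j ∈ I`. -/
def LSub (I : Finset (Fin N)) :
    Matrix (Σ i : I, Fin (P.nv i)) (Σ i : I, Fin (P.nw i)) (RatFunc ℝ) :=
  P.L.submatrix (fun q => ⟨q.1, q.2⟩) (fun q => ⟨q.1, q.2⟩)

/-- The loop matrix `1 - diag(G_{w_i v_i})_{i ∈ I} L_I`. -/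
noncomputable def loop (I : Finset (Fin N)) :
    Matrix (Σ i : I, Fin (P.nw i)) (Σ i : I, Fin (P.nw i)) (RatFunc ℝ) :=
  1 - Matrix.blockDiagonal' (fun i : I => P.Gwv i) * P.LSub I

/-- Well-posedness of the network with subsystems `I`: the loop matrix is invertible with
proper inverse, so that (all open-loop transfer matrices being proper) all closed-loop
transfer matrices are well defined and proper. -/
def WellPosed (I : Finset (Fin N)) : Prop :=
  IsUnit (P.loop I) ∧ IsProper (P.loop I)⁻¹

/-- `Q_I = L_I (1 - diag(G_{w_i v_i}) L_I)⁻¹`. -/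
noncomputable def Q (I : Finset (Fin N)) :
    Matrix (Σ i : I, Fin (P.nv i)) (Σ i : I, Fin (P.nw i)) (RatFunc ℝ) :=
  P.LSub I * (P.loop I)⁻¹

/-- `T_{v_i a_{-i}}`: the transfer matrix, in the network with subsystems `I`, to the
interaction `v_i` from the attacks on all the subsystems in `I` other than `i`.  It consists of
the rows of `Q_I diag(G_{w_j a_j})_{j ∈ I}` that belong to `i` and the columns that do not. -/
noncomputable def Tva (I : Finset (Fin N)) (i : I) :
    Matrix (Fin (P.nv i)) {q : Σ j : I, Fin (P.na j) // q.1 ≠ i} (RatFunc ℝ) :=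
  (P.Q I * Matrix.blockDiagonal' (fun j : I => P.Gwa j)).submatrix
    (fun k => ⟨i, k⟩) Subtype.val

/-- The signals `r, a, x, v, w, y` satisfy the equations of the network with subsystems `I`,
with zero initial state. -/
structure IsTrajectory (I : Finset (Fin N))
    (r : ∀ i : I, ℝ → Fin (P.nr i) → ℝ) (a : ∀ i : I, ℝ → Fin (P.na i) → ℝ)
    (x : ∀ i : I, ℝ → Fin (P.nx i) → ℝ) (v : ∀ i : I, ℝ → Fin (P.nv i) → ℝ)
    (w : ∀ i : I, ℝ → Fin (P.nw i) → ℝ) (y : ∀ i : I, ℝ → Fin (P.ny i) → ℝ) : Prop where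
  signal_r : ∀ i, IsSignal (r i)
  signal_a : ∀ i, IsSignal (a i)
  signal_v : ∀ i, IsSignal (v i)
  signal_w : ∀ i, IsSignal (w i)
  state : ∀ i : I, IsStateTrajectory (P.A i)
    (fun t => (P.B i).mulVec (r i t) + (P.U i).mulVec (v i t) + (P.X i).mulVec (a i t)) (x i)
  output : ∀ i : I, ∀ᵐ t ∂timeMeasure, y i t =
    (P.C i).mulVec (x i t) + (P.D i).mulVec (r i t) + (P.V i).mulVec (v i t) +
      (P.Y i).mulVec (a i t)
  outflow : ∀ i : I, ∀ᵐ t ∂timeMeasure, w i t =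
    (P.E i).mulVec (x i t) + (P.F i).mulVec (r i t) + (P.W i).mulVec (v i t) +
      (P.Z i).mulVec (a i t)
  interaction : IsResponse (P.LSub I) (stack w) (stack v)

/-- Internal stability of the network with subsystems `I`: with `L_I` in state-space form, every
motion of the interconnection without external inputs tends to zero.  Hidden modes of a
realization of `L_I` stay among these motions, so it amounts to the same to ask this of some
realization or of the stabilizable and detectable ones. -/
def InternallyStable (I : Finset (Fin N)) : Prop :=
  ∃ K : StateSpace (Σ i : I, Fin (P.nw i)) (Σ i : I, Fin (P.nv i)),
    K.transfer = P.LSub I ∧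
    ∀ (x : ∀ i : I, ℝ → Fin (P.nx i) → ℝ) (ξ : ℝ → Fin K.order → ℝ)
      (v : ∀ i : I, ℝ → Fin (P.nv i) → ℝ) (w : ∀ i : I, ℝ → Fin (P.nw i) → ℝ),
      (∀ t : ℝ, 0 ≤ t →
        (∀ i : I, HasDerivWithinAt (x i)
          ((P.A i).mulVec (x i t) + (P.U i).mulVec (v i t)) (Set.Ici 0) t) ∧
        (∀ i : I, w i t = (P.E i).mulVec (x i t) + (P.W i).mulVec (v i t)) ∧
        HasDerivWithinAt ξ (K.A.mulVec (ξ t) + K.B.mulVec (stack w t)) (Set.Ici 0) t ∧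
        stack v t = K.C.mulVec (ξ t) + K.D.mulVec (stack w t)) →
      (∀ i, Tendsto (x i) atTop (𝓝 0)) ∧ Tendsto ξ atTop (𝓝 0)

/-- `a` is an undetectable attack (with knowledge of the initial state) on the network with
subsystems `I`: it is a nonzero attack, and, for every reference, the outputs with the attack
`a` and without any attack coincide. -/
def IsUndetectable (I : Finset (Fin N)) (a : ∀ i : I, ℝ → Fin (P.na i) → ℝ) : Prop :=
  (∀ i, IsSignal (a i)) ∧ ¬ (∀ i, IsZeroSignal (a i)) ∧
    ∀ r x v w y x' v' w' y', P.IsTrajectory I r a x v w y →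
      P.IsTrajectory I r (fun _ _ => 0) x' v' w' y' →
      ∀ i, ∀ᵐ t ∂timeMeasure, y i t = y' i t

/-! ### The residual generator -/

/-- The signals satisfy the equations of the distributed observer (zero initial state)
`x̂ᵢ' = Aᵢ x̂ᵢ + Bᵢ rᵢ + Uᵢ v̂ᵢ + μᵢ`, `ŷᵢ = Cᵢ x̂ᵢ + Dᵢ rᵢ + Vᵢ v̂ᵢ`,
`ŵᵢ = Eᵢ x̂ᵢ + Fᵢ rᵢ + Wᵢ v̂ᵢ - Eᵢ χ̂ᵢ`, where `χ̂ᵢ' = Aᵢ χ̂ᵢ + μᵢ` and `μᵢ = Hᵢ (yᵢ - ŷᵢ)`,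
with the communication `v̂ = L_I ŵ`, driven by `r` and `y`. -/
structure IsObserverTrajectory (H : ∀ i, Matrix (Fin (P.nx i)) (Fin (P.ny i)) ℝ)
    (I : Finset (Fin N))
    (r : ∀ i : I, ℝ → Fin (P.nr i) → ℝ) (y : ∀ i : I, ℝ → Fin (P.ny i) → ℝ)
    (xh χh : ∀ i : I, ℝ → Fin (P.nx i) → ℝ) (vh : ∀ i : I, ℝ → Fin (P.nv i) → ℝ)
    (wh : ∀ i : I, ℝ → Fin (P.nw i) → ℝ) (yh : ∀ i : I, ℝ → Fin (P.ny i) → ℝ) : Prop where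
  signal_v : ∀ i, IsSignal (vh i)
  signal_w : ∀ i, IsSignal (wh i)
  state : ∀ i : I, IsStateTrajectory (P.A i)
    (fun t => (P.B i).mulVec (r i t) + (P.U i).mulVec (vh i t) +
      (H i).mulVec (y i t - yh i t)) (xh i)
  rectifier : ∀ i : I, IsStateTrajectory (P.A i)
    (fun t => (H i).mulVec (y i t - yh i t)) (χh i)
  output : ∀ i : I, ∀ᵐ t ∂timeMeasure, yh i t =
    (P.C i).mulVec (xh i t) + (P.D i).mulVec (r i t) + (P.V i).mulVec (vh i t)
  outflow : ∀ i : I, ∀ᵐ t ∂timeMeasure, wh i t =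
    (P.E i).mulVec (xh i t) + (P.F i).mulVec (r i t) + (P.W i).mulVec (vh i t) -
      (P.E i).mulVec (χh i t)
  communication : IsResponse (P.LSub I) (stack wh) (stack vh)

/-- With the filter `S`, the residual `ε = S (y_i - ŷ_i)` at subsystem `i` of the network with
subsystems `I` satisfies `ε ≠ 0 ↔ a_i ≠ 0`, whatever the reference and the attacks on the
subsystems in `I`. -/
def Isolates (H : ∀ i, Matrix (Fin (P.nx i)) (Fin (P.ny i)) ℝ) (I : Finset (Fin N)) (i : I)
    {k : ℕ} (S : Matrix (Fin k) (Fin (P.ny i)) (RatFunc ℝ)) : Prop :=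
  ∀ r a x v w y xh χh vh wh yh, P.IsTrajectory I r a x v w y →
    P.IsObserverTrajectory H I r y xh χh vh wh yh →
    ∀ ε : ℝ → Fin k → ℝ, IsResponse S (fun t => y i t - yh i t) ε →
      (¬ IsZeroSignal ε ↔ ¬ IsZeroSignal (a i))

/-- The local condition `rank [G_{y_i a_i} G_{y_i v_i}] = dim a_i + rank G_{y_i v_i}`. -/
def LocalRankCondition (i : Fin N) : Prop :=
  (Matrix.fromCols (P.Gya i) (P.Gyv i)).rank = P.na i + (P.Gyv i).rank

end NetworkedSystem

open scoped NNReal Polynomial nonZeroDivisors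

/-! ### The integration operator on continuous functions -/

/-! The signals have no growth bound, so Mikusiński's operational calculus replaces the Laplace
transform. Nonzero polynomials in the integration operator are injective on continuous functions on
`[0, ∞)` (`aeval_integration_injective`). Localizing at them embeds these functions in a vector
space over the rational functions, on which `s` acts as the inverse of integration. A locally
integrable signal is represented by `s` times its continuous primitive. The representation is
faithful (`operator_eq_zero_iff`), so the network and observer equations become linear algebra over
the field of rational functions.

For (a), write `η = y - ŷ`. Subtracting observer from subsystem gives `(1 + C (s - A)⁻¹ H) η = G_yv
(v - v̂) + G_ya a` (`act_openLoop_residual`), whatever the network. The rank condition provides a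
rational `T` with `T G_ya = 1` and `T G_yv = 0` (`exists_mul_eq_one_of_rank_fromCols`). The filter
`S = c T (1 + C (s - A)⁻¹ H)`, with a nonzero scalar `c` that makes it proper and stable, yields `ε
= c a`.

For (b), put `T = S (1 + C (s - A)⁻¹ H)⁻¹`. Every rational vector `α` becomes the transform of an
actual attack after multiplication by a high power of `s⁻¹`. The rectifier lets the observers run
with `v̂ = 0`, so isolation says that `T (G_yv ν + G_ya α_i) = 0` exactly when `α_i = 0`, where `ν`
is the inflow at `i` caused by `α` (`exists_trajectories`). Attacks with `α_i = 0` give `T G_yv T_va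
= 0`, hence `T G_yv = 0` by right invertibility. Attacks on subsystem `i` then show that `T G_ya` is
injective, and the rank condition follows (`rank_fromCols_of_mul`). -/

/-- A locally integrable function on `[0, ∞)`, in the scalar case. -/
abbrev IsScalarSignal (u : ℝ → ℝ) : Prop :=
  LocallyIntegrableOn u (Set.Ici (0 : ℝ)) volume

theorem IsScalarSignal.intervalIntegrable {u : ℝ → ℝ} (hu : IsScalarSignal u) {a b : ℝ}
    (ha : 0 ≤ a) (hb : 0 ≤ b) : IntervalIntegrable u volume a b := by
  rw [intervalIntegrable_iff]
  refine (hu.integrableOn_compact_subset ?_ isCompact_uIcc).mono_set Set.uIoc_subset_uIcc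
  intro x hx
  exact (le_min ha hb).trans hx.1

/-- Cutting off at `0` gives a function on the whole line, to which continuity and differentiation
of primitives apply. -/
theorem IsScalarSignal.locallyIntegrable_indicator {u : ℝ → ℝ} (hu : IsScalarSignal u) :
    LocallyIntegrable ((Set.Ici (0 : ℝ)).indicator u) volume := by
  rw [locallyIntegrable_iff]
  intro k hk
  rw [IntegrableOn, integrable_indicator_iff measurableSet_Ici, IntegrableOn,
    Measure.restrict_restrict measurableSet_Ici]
  exact hu.integrableOn_compact_subset Set.inter_subset_left (hk.inter_left isClosed_Ici)

theorem continuous_intervalIntegral_nnreal {u : ℝ → ℝ} (hu : IsScalarSignal u) :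
    Continuous fun t : ℝ≥0 => ∫ s in (0 : ℝ)..t, u s := by
  have h : ∀ a b : ℝ, IntervalIntegrable ((Set.Ici (0 : ℝ)).indicator u) volume a b := fun a b =>
    intervalIntegrable_iff.mpr <|
      (hu.locallyIntegrable_indicator.integrableOn_isCompact isCompact_uIcc).mono_set
        Set.uIoc_subset_uIcc
  have hc := (intervalIntegral.continuous_primitive h 0).comp NNReal.continuous_coe
  refine hc.congr fun t => ?_
  refine intervalIntegral.integral_congr fun s hs => ?_
  rw [Set.uIcc_of_le t.coe_nonneg] at hs
  exact Set.indicator_of_mem hs.1 u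

open Classical in
/-- The primitive vanishing at `0` of a locally integrable function on `[0, ∞)`. -/
noncomputable def primitive (u : ℝ → ℝ) : C(ℝ≥0, ℝ) :=
  if h : IsScalarSignal u then ⟨_, continuous_intervalIntegral_nnreal h⟩ else 0

theorem primitive_apply {u : ℝ → ℝ} (hu : IsScalarSignal u) (t : ℝ≥0) :
    primitive u t = ∫ s in (0 : ℝ)..t, u s := by
  rw [primitive, dif_pos hu]
  rfl

theorem primitive_add {u v : ℝ → ℝ} (hu : IsScalarSignal u) (hv : IsScalarSignal v) :
    primitive (fun t => u t + v t) = primitive u + primitive v := by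
  ext t
  rw [primitive_apply (show IsScalarSignal fun t => u t + v t from hu.add hv),
    ContinuousMap.add_apply, primitive_apply hu, primitive_apply hv]
  exact intervalIntegral.integral_add (hu.intervalIntegrable le_rfl t.2)
    (hv.intervalIntegrable le_rfl t.2)

theorem primitive_smul {u : ℝ → ℝ} (hu : IsScalarSignal u) (c : ℝ) :
    primitive (fun t => c * u t) = c • primitive u := by
  ext t
  rw [primitive_apply (show IsScalarSignal fun t => c * u t from hu.smul c),
    ContinuousMap.smul_apply, primitive_apply hu]
  exact intervalIntegral.integral_const_mul c u

theorem primitive_congr {u v : ℝ → ℝ} (hu : IsScalarSignal u) (hv : IsScalarSignal v)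
    (h : ∀ᵐ t ∂timeMeasure, u t = v t) : primitive u = primitive v := by
  ext t
  rw [primitive_apply hu, primitive_apply hv]
  refine intervalIntegral.integral_congr_ae ?_
  filter_upwards [(ae_restrict_iff' measurableSet_Ici).1 h] with s hs hst
  rw [Set.uIoc_of_le t.coe_nonneg] at hst
  exact hs hst.1.le

/-- By Lebesgue differentiation the primitive has derivative `u t` at almost every `t`, and it is
locally constant at `t > 0`. -/
theorem ae_eq_zero_of_primitive_eq_zero {u : ℝ → ℝ} (hu : IsScalarSignal u)
    (h : primitive u = 0) : ∀ᵐ t ∂timeMeasure, u t = 0 := by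
  refine (ae_restrict_iff' measurableSet_Ici).2 ?_
  have h0 : ∀ᵐ t : ℝ ∂volume, t ≠ 0 := by
    simp [ae_iff]
  filter_upwards [LocallyIntegrable.ae_hasDerivAt_integral hu.locallyIntegrable_indicator, h0]
    with t ht ht0 ht1
  have htpos : 0 < t := lt_of_le_of_ne ht1 (Ne.symm ht0)
  have hz : (fun x : ℝ => ∫ s in (0 : ℝ)..x, (Set.Ici (0 : ℝ)).indicator u s) =ᶠ[𝓝 t]
      fun _ => 0 := by
    filter_upwards [Ioi_mem_nhds htpos] with x hx
    have hx0 : (0 : ℝ) ≤ x := (Set.mem_Ioi.1 hx).le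
    have h1 := (primitive_apply hu ⟨x, hx0⟩).symm.trans (DFunLike.congr_fun h ⟨x, hx0⟩)
    refine Eq.trans (intervalIntegral.integral_congr fun s hs => ?_) h1
    change s ∈ Set.uIcc 0 x at hs
    rw [Set.uIcc_of_le hx0] at hs
    exact Set.indicator_of_mem hs.1 u
  have h2 := (ht 0).unique ((hasDerivAt_const t (0 : ℝ)).congr_of_eventuallyEq hz)
  rwa [Set.indicator_of_mem (show t ∈ Set.Ici (0 : ℝ) from ht1)] at h2

/-- The extension of a continuous function on `[0, ∞)` to the real line by a constant. -/
def extendConst (f : C(ℝ≥0, ℝ)) (t : ℝ) : ℝ := f t.toNNReal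

theorem continuous_extendConst (f : C(ℝ≥0, ℝ)) : Continuous (extendConst f) :=
  f.continuous.comp continuous_real_toNNReal

theorem extendConst_coe (f : C(ℝ≥0, ℝ)) (t : ℝ≥0) : extendConst f t = f t := by
  rw [extendConst, Real.toNNReal_coe]

theorem isScalarSignal_extendConst (f : C(ℝ≥0, ℝ)) : IsScalarSignal (extendConst f) :=
  (continuous_extendConst f).locallyIntegrable.locallyIntegrableOn _

/-- The operator `f ↦ ∫₀ᵗ f`. -/
noncomputable def integration : Module.End ℝ C(ℝ≥0, ℝ) where
  toFun f := primitive (extendConst f)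
  map_add' f g := primitive_add (isScalarSignal_extendConst f) (isScalarSignal_extendConst g)
  map_smul' c f := primitive_smul (isScalarSignal_extendConst f) c

theorem integration_apply (f : C(ℝ≥0, ℝ)) (t : ℝ≥0) :
    integration f t = ∫ s in (0 : ℝ)..t, extendConst f s :=
  primitive_apply (isScalarSignal_extendConst f) t

theorem hasDerivAt_integral_extendConst (f : C(ℝ≥0, ℝ)) (t : ℝ) :
    HasDerivAt (fun x => ∫ s in (0 : ℝ)..x, extendConst f s) (extendConst f t) t :=
  intervalIntegral.integral_hasDerivAt_right ((continuous_extendConst f).intervalIntegrable _ _)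
    (continuous_extendConst f).stronglyMeasurable.stronglyMeasurableAtFilter
    (continuous_extendConst f).continuousAt

/-- Differentiating the integral recovers `f`; derivatives within `[0, ∞)` cover the endpoint `0`.
-/
theorem integration_injective : Function.Injective integration := by
  rw [injective_iff_map_eq_zero]
  intro f hf
  ext t
  have h1 : HasDerivWithinAt (fun x => ∫ s in (0 : ℝ)..x, extendConst f s) (extendConst f t)
      (Set.Ici 0) t :=
    (hasDerivAt_integral_extendConst f t).hasDerivWithinAt
  have h2 : HasDerivWithinAt (fun x => ∫ s in (0 : ℝ)..x, extendConst f s) 0 (Set.Ici 0) t := by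
    refine (hasDerivWithinAt_const (t : ℝ) (Set.Ici 0) (0 : ℝ)).congr_of_mem (fun x hx => ?_) t.2
    exact (integration_apply f ⟨x, hx⟩).symm.trans (DFunLike.congr_fun hf ⟨x, hx⟩)
  have := (uniqueDiffOn_Ici (0 : ℝ) t t.2).eq_deriv _ h1 h2
  rwa [extendConst_coe] at this

/-- A Volterra equation `q₀ f + q₁ J f + ⋯ = 0` with `q₀ ≠ 0` has only the zero solution. -/
theorem eq_zero_of_aeval_integration_eq_zero {q : ℝ[X]} (hq : q.coeff 0 ≠ 0) {f : C(ℝ≥0, ℝ)}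
    (hf : Polynomial.aeval integration q f = 0) : f = 0 := by
  set n := q.natDegree
  have hsum : q.coeff 0 • f + ∑ j : Fin n, q.coeff (j + 1) • (integration ^ (j + 1 : ℕ)) f = 0 := by
    rw [Polynomial.aeval_eq_sum_range, Finset.sum_range_succ', LinearMap.add_apply,
      LinearMap.sum_apply, Finset.sum_range] at hf
    rw [← hf, add_comm]
    rfl
  -- The functions `J f, …, Jⁿ f` solve a linear equation `y' = A y` with `y(0) = 0`. The first has
  -- derivative `f`, which `hsum` expresses through the others, and each later one has its
  -- predecessor as derivative. Uniqueness forces `y = 0`, and `hsum` reduces to `q₀ f = 0`.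
  let y : ℝ → Fin n → ℝ := fun t j => ∫ s in (0 : ℝ)..t, extendConst ((integration ^ (j : ℕ)) f) s
  let A : (Fin n → ℝ) →ₗ[ℝ] (Fin n → ℝ) := LinearMap.pi fun j =>
    if h : (j : ℕ) = 0 then -(q.coeff 0)⁻¹ • ∑ l : Fin n, q.coeff (l + 1) • LinearMap.proj l
    else LinearMap.proj ⟨j - 1, by omega⟩
  have hy : ∀ (t : ℝ≥0) (j : Fin n), y t j = (integration ^ (j + 1 : ℕ)) f t := by
    intro t j
    rw [pow_succ', Module.End.mul_apply, integration_apply]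
  have hyd : ∀ t : ℝ, 0 ≤ t → HasDerivAt y (A (y t)) t := by
    intro t ht
    lift t to ℝ≥0 using ht
    rw [hasDerivAt_pi]
    intro j
    refine (hasDerivAt_integral_extendConst ((integration ^ (j : ℕ)) f) t).congr_deriv ?_
    rw [extendConst_coe, LinearMap.pi_apply]
    split_ifs with h
    · rw [h, pow_zero, Module.End.one_apply]
      have h1 := DFunLike.congr_fun hsum t
      simp only [ContinuousMap.add_apply, ContinuousMap.smul_apply, ContinuousMap.sum_apply,
        ContinuousMap.zero_apply, smul_eq_mul] at h1
      simp only [LinearMap.smul_apply, LinearMap.sum_apply, LinearMap.proj_apply, smul_eq_mul, hy]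
      field_simp
      linarith
    · rw [LinearMap.proj_apply, hy]
      congr 3
      simp only
      omega
  have hA : ∀ t : ℝ, LipschitzWith ‖LinearMap.toContinuousLinearMap A‖₊ (fun x => A x) := fun t =>
    (LinearMap.toContinuousLinearMap A).lipschitz
  have hyc : Continuous y := continuous_pi fun j => continuous_iff_continuousAt.2 fun t =>
    (hasDerivAt_integral_extendConst _ t).continuousAt
  have hzero : ∀ t : ℝ≥0, y t = 0 := by
    intro t
    refine ODE_solution_unique hA hyc.continuousOn
      (fun s hs => (hyd s hs.1).hasDerivWithinAt) (g := fun _ => 0) continuousOn_const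
      (fun s hs => by rw [map_zero]; exact hasDerivWithinAt_const _ _ _) ?_
      (Set.right_mem_Icc.2 t.2)
    ext j
    simp [y]
  have : q.coeff 0 • f = 0 := by
    rw [← hsum, eq_comm, add_eq_left]
    refine Finset.sum_eq_zero fun j _ => ?_
    ext t
    rw [ContinuousMap.smul_apply, ← hy, hzero]
    simp
  exact (smul_eq_zero.1 this).resolve_left hq

/-- Split off the largest power of `X` from `q`: that power acts injectively because integration
does, and the cofactor has nonzero constant term, so it gives a Volterra equation. -/
theorem aeval_integration_injective {q : ℝ[X]} (hq : q ≠ 0) :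
    Function.Injective (Polynomial.aeval integration q) := by
  obtain ⟨p, hp, hpX⟩ := Polynomial.exists_eq_pow_rootMultiplicity_mul_and_not_dvd q hq 0
  rw [map_zero, sub_zero] at hp hpX
  rw [hp, map_mul, map_pow, Polynomial.aeval_X, Module.End.coe_mul, Module.End.coe_pow]
  refine (integration_injective.iterate _).comp ?_
  rw [injective_iff_map_eq_zero]
  exact fun f hf => eq_zero_of_aeval_integration_eq_zero
    (fun h => hpX (Polynomial.X_dvd_iff.2 h)) hf

/-! ### Signals as elements of a vector space over the rational functions -/

/-- The endomorphism `s ↦ s⁻¹` of the field of rational functions. -/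
noncomputable def invX : RatFunc ℝ →+* RatFunc ℝ :=
  RatFunc.liftRingHom (Polynomial.aeval (R := ℝ) (RatFunc.X : RatFunc ℝ)⁻¹).toRingHom <| by
    refine nonZeroDivisors_le_comap_nonZeroDivisors_of_injective _ ?_
    refine transcendental_iff_injective.1 fun h => RatFunc.transcendental_X (K := ℝ) ?_
    simpa using h.inv

theorem invX_C (c : ℝ) : invX (RatFunc.C c) = RatFunc.C c := by
  rw [invX, RatFunc.liftRingHom_C]
  simp

theorem invX_X : invX RatFunc.X = RatFunc.X⁻¹ := by
  rw [invX, RatFunc.liftRingHom_X]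
  simp

/-- Operational calculus: the localization of `C([0, ∞))` at the nonzero polynomials in the
integration operator. -/
def OperatorSpace : Type :=
  LocalizedModule ℝ[X]⁰ (Module.AEval' integration)

namespace OperatorSpace

noncomputable instance : AddCommGroup OperatorSpace :=
  inferInstanceAs (AddCommGroup (LocalizedModule ℝ[X]⁰ (Module.AEval' integration)))

/-- `RatFunc.X` acts as the inverse of the integration operator. -/
noncomputable instance : Module (RatFunc ℝ) OperatorSpace :=
  letI : Module (RatFunc ℝ) (LocalizedModule ℝ[X]⁰ (Module.AEval' integration)) :=
    LocalizedModule.moduleOfIsLocalization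
  Module.compHom (LocalizedModule ℝ[X]⁰ (Module.AEval' integration)) invX

/-- The embedding of the continuous functions. -/
noncomputable def embed (f : C(ℝ≥0, ℝ)) : OperatorSpace :=
  LocalizedModule.mk (Module.AEval'.of integration f) 1

theorem embed_add (f g : C(ℝ≥0, ℝ)) : embed (f + g) = embed f + embed g := by
  simp only [embed, map_add]
  refine Eq.trans ?_ LocalizedModule.mk_add_mk.symm
  rw [one_smul, one_smul, one_mul]

/-- After `s ↦ s⁻¹`, a rational function that is a polynomial needs no denominator and acts on the
continuous functions themselves. -/
theorem smul_embed {g : RatFunc ℝ} {p : ℝ[X]} (h : invX g = algebraMap ℝ[X] (RatFunc ℝ) p)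
    (f : C(ℝ≥0, ℝ)) : g • embed f = embed (Polynomial.aeval integration p f) := by
  let _ : SMul (RatFunc ℝ) (LocalizedModule ℝ[X]⁰ (Module.AEval' integration)) :=
    LocalizedModule.smulOfIsLocalization (RatFunc ℝ)
  change invX g • LocalizedModule.mk (S := ℝ[X]⁰) (Module.AEval'.of integration f) 1 =
    LocalizedModule.mk (p • Module.AEval'.of integration f) 1
  rw [h, ← IsLocalization.mk'_one (M := ℝ[X]⁰), LocalizedModule.mk'_smul_mk, one_mul]

theorem embed_smul (c : ℝ) (f : C(ℝ≥0, ℝ)) : embed (c • f) = RatFunc.C c • embed f := by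
  rw [smul_embed (p := Polynomial.C c) (by rw [invX_C, RatFunc.algebraMap_C])]
  simp

theorem embed_integration (f : C(ℝ≥0, ℝ)) :
    embed (integration f) = (RatFunc.X : RatFunc ℝ)⁻¹ • embed f := by
  rw [smul_embed (p := Polynomial.X) (by rw [map_inv₀, invX_X, inv_inv, RatFunc.algebraMap_X])]
  simp

/-- The localization inverts only operators that are already injective, so it kills nothing. -/
theorem embed_injective : Function.Injective embed := by
  intro f g h
  obtain ⟨u, hu⟩ := LocalizedModule.mk_eq.1 h
  rw [one_smul, one_smul] at hu
  exact aeval_integration_injective (nonZeroDivisors.ne_zero u.2)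
    ((Module.AEval'.of integration).injective hu)

theorem embed_zero : embed 0 = 0 := by
  simpa using embed_smul 0 0

end OperatorSpace

open OperatorSpace

/-- The element of the operator space given by a scalar signal. -/
noncomputable def operator (u : ℝ → ℝ) : OperatorSpace :=
  (RatFunc.X : RatFunc ℝ) • embed (primitive u)

theorem operator_add {u v : ℝ → ℝ} (hu : IsScalarSignal u) (hv : IsScalarSignal v) :
    operator (fun t => u t + v t) = operator u + operator v := by
  rw [operator, primitive_add hu hv, embed_add, smul_add]
  rfl

theorem operator_smul {u : ℝ → ℝ} (hu : IsScalarSignal u) (c : ℝ) :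
    operator (fun t => c * u t) = RatFunc.C c • operator u := by
  rw [operator, primitive_smul hu, embed_smul, smul_comm]
  rfl

theorem operator_congr {u v : ℝ → ℝ} (hu : IsScalarSignal u) (hv : IsScalarSignal v)
    (h : ∀ᵐ t ∂timeMeasure, u t = v t) : operator u = operator v := by
  rw [operator, primitive_congr hu hv h]
  rfl

/-- This faithfulness carries almost-everywhere identities of signals to operators and back. -/
theorem operator_eq_zero_iff {u : ℝ → ℝ} (hu : IsScalarSignal u) :
    operator u = 0 ↔ ∀ᵐ t ∂timeMeasure, u t = 0 := by
  constructor
  · intro h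
    refine ae_eq_zero_of_primitive_eq_zero hu (embed_injective ?_)
    rw [embed_zero]
    exact (smul_eq_zero.1 h).resolve_left RatFunc.X_ne_zero
  · intro h
    -- Zero is written as `0 * 0` so that `primitive_smul` evaluates its primitive.
    rw [operator, primitive_congr hu (v := fun _ => 0 * (0 : ℝ)) ?_ (by simpa using h),
      primitive_smul (u := fun _ => 0) (by exact locallyIntegrableOn_zero), zero_smul, embed_zero,
      smul_zero]
    simpa using locallyIntegrableOn_zero

theorem operator_extendConst (f : C(ℝ≥0, ℝ)) : operator (extendConst f) = embed f := by
  change (RatFunc.X : RatFunc ℝ) • embed (integration f) = _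
  rw [embed_integration, smul_smul, mul_inv_cancel₀ RatFunc.X_ne_zero, one_smul]

/-- Integration of signals is division by `RatFunc.X`. -/
theorem operator_eq_inv_X_smul {u x : ℝ → ℝ} (hu : IsScalarSignal u) (hx : IsScalarSignal x)
    (h : ∀ t : ℝ, 0 ≤ t → x t = ∫ s in (0 : ℝ)..t, u s) :
    operator x = (RatFunc.X : RatFunc ℝ)⁻¹ • operator u := by
  have : primitive x = integration (primitive u) := by
    refine primitive_congr hx (isScalarSignal_extendConst _) ?_
    refine (ae_restrict_iff' measurableSet_Ici).2 (ae_of_all _ fun t ht => ?_)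
    rw [h t ht, extendConst, primitive_apply hu, Real.coe_toNNReal t ht]
  rw [operator, this, embed_integration, operator, smul_comm]

/-- Converse passage to `operator_eq_inv_X_smul`: an operator identity is turned into an integral
equation, which is how trajectories are constructed. -/
theorem extendConst_eq_integral {f : C(ℝ≥0, ℝ)} {u : ℝ → ℝ} (hu : IsScalarSignal u)
    (h : embed f = (RatFunc.X : RatFunc ℝ)⁻¹ • operator u) (t : ℝ) (ht : 0 ≤ t) :
    extendConst f t = ∫ s in (0 : ℝ)..t, u s := by
  rw [operator, smul_smul, inv_mul_cancel₀ RatFunc.X_ne_zero, one_smul] at h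
  rw [embed_injective h, extendConst, primitive_apply hu, Real.coe_toNNReal t ht]

/-! ### Action of transfer matrices on vectors of operators -/

section Act

variable {l m n : Type*} [Fintype m] [Fintype n]

/-- The product of a matrix of rational functions with a vector of operators. -/
noncomputable def act (G : Matrix l m (RatFunc ℝ)) (z : m → OperatorSpace) : l → OperatorSpace :=
  fun i => ∑ j, G i j • z j

theorem act_mul (G : Matrix l m (RatFunc ℝ)) (H : Matrix m n (RatFunc ℝ))
    (z : n → OperatorSpace) : act (G * H) z = act G (act H z) := by
  ext i
  simp only [act, Matrix.mul_apply, Finset.sum_smul, Finset.smul_sum, mul_smul]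
  exact Finset.sum_comm

theorem act_add (G : Matrix l m (RatFunc ℝ)) (z w : m → OperatorSpace) :
    act G (z + w) = act G z + act G w := by
  ext i
  simp [act, Finset.sum_add_distrib]

theorem act_sub (G : Matrix l m (RatFunc ℝ)) (z w : m → OperatorSpace) :
    act G (z - w) = act G z - act G w := by
  ext i
  simp [act, smul_sub]

theorem act_smul (G : Matrix l m (RatFunc ℝ)) (c : RatFunc ℝ) (z : m → OperatorSpace) :
    act G (c • z) = c • act G z := by
  ext i
  simp [act, Finset.smul_sum, smul_comm c]

theorem add_act (G H : Matrix l m (RatFunc ℝ)) (z : m → OperatorSpace) :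
    act (G + H) z = act G z + act H z := by
  ext i
  simp [act, add_smul, Finset.sum_add_distrib]

theorem sub_act (G H : Matrix l m (RatFunc ℝ)) (z : m → OperatorSpace) :
    act (G - H) z = act G z - act H z := by
  ext i
  simp [act, sub_smul]

theorem one_act [DecidableEq m] (z : m → OperatorSpace) :
    act (1 : Matrix m m (RatFunc ℝ)) z = z := by
  ext i
  simp [act, Matrix.one_apply, ite_smul]

theorem scalar_act [DecidableEq m] (c : RatFunc ℝ) (z : m → OperatorSpace) :
    act (Matrix.scalar m c) z = c • z := by
  ext i
  simp [act, Matrix.diagonal_apply, ite_smul]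

theorem zero_act (z : m → OperatorSpace) : act (0 : Matrix l m (RatFunc ℝ)) z = 0 := by
  ext i
  simp [act]

theorem act_zero (G : Matrix l m (RatFunc ℝ)) : act G (0 : m → OperatorSpace) = 0 := by
  ext i
  simp [act]

/-- The action on rational multiples of a fixed operator. -/
theorem act_smul_const (G : Matrix l m (RatFunc ℝ)) (g : m → RatFunc ℝ) (e : OperatorSpace) :
    act G (fun j => g j • e) = fun i => G.mulVec g i • e := by
  ext i
  simp [act, Matrix.mulVec, dotProduct, Finset.sum_smul, mul_smul]

end Act

/-! ### The resolvent -/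

section Resolvent

variable {n : Type*} [Fintype n] [DecidableEq n]

/-- The determinant is the characteristic polynomial, which is monic and hence nonzero. -/
theorem isUnit_pencil (A : Matrix n n ℝ) :
    IsUnit (Matrix.scalar n (RatFunc.X : RatFunc ℝ) - A.map RatFunc.C) := by
  have h : Matrix.scalar n (RatFunc.X : RatFunc ℝ) - A.map RatFunc.C =
      (Matrix.charmatrix A).map (algebraMap ℝ[X] (RatFunc ℝ)) := by
    ext i j
    by_cases hij : i = j
    · subst hij
      simp
    · simp [hij]
  rw [Matrix.isUnit_iff_isUnit_det, h, ← RingHom.mapMatrix_apply, ← RingHom.map_det,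
    isUnit_iff_ne_zero]
  exact (map_ne_zero_iff _ (IsFractionRing.injective _ _)).2 (Matrix.charpoly_monic A).ne_zero

theorem eq_resolvent_act {A : Matrix n n ℝ} {x f : n → OperatorSpace}
    (h : (RatFunc.X : RatFunc ℝ) • x = act (A.map RatFunc.C) x + f) :
    x = act (Matrix.scalar n RatFunc.X - A.map RatFunc.C)⁻¹ f := by
  rw [eq_comm, ← sub_eq_iff_eq_add'.2 h, ← scalar_act, ← sub_act, ← act_mul,
    Matrix.nonsing_inv_mul _ ((Matrix.isUnit_iff_isUnit_det _).1 (isUnit_pencil A)), one_act]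

theorem X_smul_resolvent_mulVec (A : Matrix n n ℝ) (f : n → RatFunc ℝ) :
    (RatFunc.X : RatFunc ℝ) • ((Matrix.scalar n RatFunc.X - A.map RatFunc.C)⁻¹.mulVec f) =
      (A.map RatFunc.C).mulVec ((Matrix.scalar n RatFunc.X - A.map RatFunc.C)⁻¹.mulVec f) + f := by
  have h : (Matrix.scalar n RatFunc.X - A.map RatFunc.C).mulVec
      ((Matrix.scalar n RatFunc.X - A.map RatFunc.C)⁻¹.mulVec f) = f := by
    rw [Matrix.mulVec_mulVec,
      Matrix.mul_nonsing_inv _ ((Matrix.isUnit_iff_isUnit_det _).1 (isUnit_pencil A)),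
      Matrix.one_mulVec]
  rw [Matrix.sub_mulVec, sub_eq_iff_eq_add'] at h
  rw [← h]
  ext i
  simp [Matrix.mulVec_diagonal]

theorem transferMatrix_mulVec {m p : Type*} [Fintype m] (A : Matrix n n ℝ) (B : Matrix n m ℝ)
    (C : Matrix p n ℝ) (D : Matrix p m ℝ) (u : m → RatFunc ℝ) :
    (transferMatrix A B C D).mulVec u = (C.map RatFunc.C).mulVec
      ((Matrix.scalar n RatFunc.X - A.map RatFunc.C)⁻¹.mulVec ((B.map RatFunc.C).mulVec u)) +
      (D.map RatFunc.C).mulVec u := by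
  rw [transferMatrix, Matrix.add_mulVec, Matrix.mulVec_mulVec, Matrix.mulVec_mulVec,
    Matrix.mul_assoc]

theorem transferMatrix_act {m p : Type*} [Fintype m] (A : Matrix n n ℝ) (B : Matrix n m ℝ)
    (C : Matrix p n ℝ) (D : Matrix p m ℝ) (u : m → OperatorSpace) :
    act (transferMatrix A B C D) u = act (C.map RatFunc.C)
      (act (Matrix.scalar n RatFunc.X - A.map RatFunc.C)⁻¹ (act (B.map RatFunc.C) u)) +
      act (D.map RatFunc.C) u := by
  rw [transferMatrix, add_act, act_mul, act_mul]

end Resolvent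

/-! ### Vector signals -/

section Signals

variable {m n : Type*} [Fintype m] [Fintype n]

theorem IsSignal.eval {u : ℝ → m → ℝ} (hu : IsSignal u) (j : m) :
    IsScalarSignal fun t => u t j := by
  rw [IsScalarSignal, locallyIntegrableOn_iff isClosed_Ici.isLocallyClosed]
  intro k hk hkc
  exact Integrable.eval (hu.integrableOn_compact_subset hk hkc) j

theorem isSignal_of_eval {u : ℝ → m → ℝ} (hu : ∀ j, IsScalarSignal fun t => u t j) :
    IsSignal u := by
  rw [IsSignal, locallyIntegrableOn_iff isClosed_Ici.isLocallyClosed]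
  intro k hk hkc
  exact Integrable.of_eval fun j => (hu j).integrableOn_compact_subset hk hkc

theorem IsSignal.add {u v : ℝ → m → ℝ} (hu : IsSignal u) (hv : IsSignal v) :
    IsSignal fun t => u t + v t :=
  LocallyIntegrableOn.add hu hv

theorem IsSignal.sub {u v : ℝ → m → ℝ} (hu : IsSignal u) (hv : IsSignal v) :
    IsSignal fun t => u t - v t :=
  LocallyIntegrableOn.sub hu hv

theorem isScalarSignal_sum {ι : Type*} (s : Finset ι) {u : ι → ℝ → ℝ}
    (hu : ∀ i ∈ s, IsScalarSignal (u i)) : IsScalarSignal fun t => ∑ i ∈ s, u i t := by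
  classical
  induction s using Finset.induction_on with
  | empty => simpa using locallyIntegrableOn_zero
  | insert a s ha ih =>
    simp only [Finset.sum_insert ha]
    exact (hu a (Finset.mem_insert_self a s)).add
      (ih fun i hi => hu i (Finset.mem_insert_of_mem hi))

theorem IsSignal.mulVec {u : ℝ → m → ℝ} (hu : IsSignal u) (A : Matrix n m ℝ) :
    IsSignal fun t => A.mulVec (u t) :=
  isSignal_of_eval fun i => isScalarSignal_sum _ fun j _ => (hu.eval j).smul (A i j)

theorem isSignal_zero : IsSignal (fun _ => 0 : ℝ → m → ℝ) :=
  locallyIntegrableOn_zero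

theorem isSignal_of_continuousOn {u : ℝ → m → ℝ} (hu : ContinuousOn u (Set.Ici 0)) :
    IsSignal u :=
  hu.locallyIntegrableOn measurableSet_Ici

theorem IsSignal.congr {u v : ℝ → m → ℝ} (hu : IsSignal u)
    (h : ∀ᵐ t ∂timeMeasure, v t = u t) : IsSignal v := by
  rw [IsSignal, locallyIntegrableOn_iff isClosed_Ici.isLocallyClosed]
  intro k hk hkc
  refine (hu.integrableOn_compact_subset hk hkc).congr ?_
  filter_upwards [ae_restrict_of_ae_restrict_of_subset hk h] with t ht
  exact ht.symm

/-- The vector of operators given by a vector signal. -/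
noncomputable def vecOperator (u : ℝ → m → ℝ) : m → OperatorSpace :=
  fun j => operator fun t => u t j

theorem vecOperator_add {u v : ℝ → m → ℝ} (hu : IsSignal u) (hv : IsSignal v) :
    vecOperator (fun t => u t + v t) = vecOperator u + vecOperator v := by
  ext j
  exact operator_add (hu.eval j) (hv.eval j)

theorem operator_sum {ι : Type*} (s : Finset ι) {u : ι → ℝ → ℝ}
    (hu : ∀ i ∈ s, IsScalarSignal (u i)) :
    operator (fun t => ∑ i ∈ s, u i t) = ∑ i ∈ s, operator (u i) := by
  classical
  induction s using Finset.induction_on with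
  | empty =>
    simp only [Finset.sum_empty]
    exact (operator_eq_zero_iff (by simpa using locallyIntegrableOn_zero)).2 (by simp)
  | insert a s ha ih =>
    simp only [Finset.sum_insert ha]
    have hs : ∀ i ∈ s, IsScalarSignal (u i) := fun i hi => hu i (Finset.mem_insert_of_mem hi)
    rw [operator_add (hu a (Finset.mem_insert_self a s)) (isScalarSignal_sum s hs), ih hs]

theorem vecOperator_mulVec {l : Type*} {u : ℝ → m → ℝ} (hu : IsSignal u) (A : Matrix l m ℝ) :
    vecOperator (fun t => A.mulVec (u t)) = act (A.map RatFunc.C) (vecOperator u) := by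
  ext i
  refine (operator_sum _ fun j _ => (hu.eval j).smul (A i j)).trans ?_
  exact Finset.sum_congr rfl fun j _ => operator_smul (hu.eval j) (A i j)

theorem vecOperator_sub {u v : ℝ → m → ℝ} (hu : IsSignal u) (hv : IsSignal v) :
    vecOperator (fun t => u t - v t) = vecOperator u - vecOperator v := by
  rw [eq_sub_iff_add_eq, ← vecOperator_add (hu.sub hv) hv]
  simp

theorem vecOperator_congr {u v : ℝ → m → ℝ} (hu : IsSignal u)
    (h : ∀ᵐ t ∂timeMeasure, v t = u t) : vecOperator v = vecOperator u := by
  ext j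
  refine operator_congr ((hu.congr h).eval j) (hu.eval j) ?_
  filter_upwards [h] with t ht
  rw [ht]

theorem vecOperator_eq_zero_iff {u : ℝ → m → ℝ} (hu : IsSignal u) :
    vecOperator u = 0 ↔ IsZeroSignal u := by
  rw [funext_iff, IsZeroSignal]
  simp only [funext_iff, ae_all_iff, Pi.zero_apply]
  exact forall_congr' fun j => operator_eq_zero_iff (hu.eval j)

theorem ae_eq_of_vecOperator_eq {u v : ℝ → m → ℝ} (hu : IsSignal u) (hv : IsSignal v)
    (h : vecOperator u = vecOperator v) : ∀ᵐ t ∂timeMeasure, u t = v t := by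
  have := (vecOperator_eq_zero_iff (hu.sub hv)).1 (by rw [vecOperator_sub hu hv, h, sub_self])
  filter_upwards [this] with t ht
  exact sub_eq_zero.1 ht

theorem isSignal_stack {ι : Type*} [Fintype ι] {d : ι → ℕ} {u : ∀ i, ℝ → Fin (d i) → ℝ}
    (hu : ∀ i, IsSignal (u i)) : IsSignal (stack u) :=
  isSignal_of_eval fun q => (hu q.1).eval q.2

/-! ### Trajectories and responses in operator form -/

theorem IsStateTrajectory.isSignal {A : Matrix n n ℝ} {f x : ℝ → n → ℝ}
    (h : IsStateTrajectory A f x) : IsSignal x :=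
  isSignal_of_continuousOn h.1

theorem integral_apply_of_isSignal {f : ℝ → n → ℝ} (hf : IsSignal f) {t : ℝ} (ht : 0 ≤ t)
    (j : n) : (∫ s in (0 : ℝ)..t, f s) j = ∫ s in (0 : ℝ)..t, f s j := by
  have hi : IntervalIntegrable f volume 0 t := by
    rw [intervalIntegrable_iff, Set.uIoc_of_le ht]
    exact (hf.integrableOn_compact_subset (fun x hx => hx.1) isCompact_Icc).mono_set
      Set.Ioc_subset_Icc_self
  exact ((ContinuousLinearMap.proj (R := ℝ) (φ := fun _ : n => ℝ) j).intervalIntegral_comp_comm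
    hi).symm

/-- The zero initial state leaves no boundary term, so the integral equation reads `s x = A x + f`.
-/
theorem IsStateTrajectory.X_smul_vecOperator {A : Matrix n n ℝ} {f x : ℝ → n → ℝ}
    (h : IsStateTrajectory A f x) (hf : IsSignal f) :
    (RatFunc.X : RatFunc ℝ) • vecOperator x = act (A.map RatFunc.C) (vecOperator x) +
      vecOperator f := by
  have hx := h.isSignal
  have hs := (hx.mulVec A).add hf
  rw [← vecOperator_mulVec hx, ← vecOperator_add (hx.mulVec A) hf]
  ext j
  have := operator_eq_inv_X_smul (hs.eval j) (hx.eval j) fun t ht => by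
    rw [h.2 t ht, integral_apply_of_isSignal hs ht]
  rw [Pi.smul_apply, vecOperator, this, smul_smul, mul_inv_cancel₀ RatFunc.X_ne_zero, one_smul]
  rfl

/-- A vector of continuous functions on `[0, ∞)` as a signal. -/
def vecExtend (F : n → C(ℝ≥0, ℝ)) : ℝ → n → ℝ := fun t j => extendConst (F j) t

theorem continuous_vecExtend {ι : Type*} (F : ι → C(ℝ≥0, ℝ)) : Continuous (vecExtend F) :=
  continuous_pi fun j => continuous_extendConst (F j)

theorem isSignal_vecExtend (F : n → C(ℝ≥0, ℝ)) : IsSignal (vecExtend F) :=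
  isSignal_of_continuousOn (continuous_vecExtend F).continuousOn

theorem vecOperator_vecExtend {ι : Type*} (F : ι → C(ℝ≥0, ℝ)) :
    vecOperator (vecExtend F) = fun j => embed (F j) := by
  ext j
  exact operator_extendConst (F j)

theorem isStateTrajectory_vecExtend {A : Matrix n n ℝ} {f : ℝ → n → ℝ} {F : n → C(ℝ≥0, ℝ)}
    (hf : IsSignal f)
    (h : (RatFunc.X : RatFunc ℝ) • vecOperator (vecExtend F) =
      act (A.map RatFunc.C) (vecOperator (vecExtend F)) + vecOperator f) :
    IsStateTrajectory A f (vecExtend F) := by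
  have hx := isSignal_vecExtend F
  have hs := (hx.mulVec A).add hf
  refine ⟨(continuous_vecExtend F).continuousOn, fun t ht => ?_⟩
  rw [← vecOperator_mulVec hx, ← vecOperator_add (hx.mulVec A) hf] at h
  ext j
  rw [integral_apply_of_isSignal hs ht]
  refine extendConst_eq_integral (hs.eval j) ?_ t ht
  have hj := congrFun h j
  rw [Pi.smul_apply, vecOperator_vecExtend] at hj
  rw [eq_inv_smul_iff₀ RatFunc.X_ne_zero, hj]
  rfl

/-- Eliminating the state by the resolvent leaves only the transfer matrix; the response is
therefore independent of the realization. -/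
theorem StateSpace.output_eq {p : Type*} [Fintype p] {K : StateSpace m p} {u : ℝ → m → ℝ}
    {y : ℝ → p → ℝ} {x : ℝ → Fin K.order → ℝ} (hu : IsSignal u)
    (hx : IsStateTrajectory K.A (fun t => K.B.mulVec (u t)) x)
    (hy : ∀ᵐ t ∂timeMeasure, y t = K.C.mulVec (x t) + K.D.mulVec (u t)) :
    vecOperator y = act K.transfer (vecOperator u) := by
  rw [vecOperator_congr ((hx.isSignal.mulVec K.C).add (hu.mulVec K.D)) hy,
    vecOperator_add (hx.isSignal.mulVec K.C) (hu.mulVec K.D), vecOperator_mulVec hx.isSignal,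
    vecOperator_mulVec hu, StateSpace.transfer, transferMatrix_act, ← vecOperator_mulVec hu K.B,
    ← eq_resolvent_act (hx.X_smul_vecOperator (hu.mulVec K.B))]

theorem IsResponse.isSignal {p : Type*} [Fintype p] {G : Matrix p m (RatFunc ℝ)} {u : ℝ → m → ℝ}
    {y : ℝ → p → ℝ} (h : IsResponse G u y) : IsSignal y := by
  obtain ⟨hu, K, -, x, hx, hy⟩ := h
  exact ((hx.isSignal.mulVec K.C).add (hu.mulVec K.D)).congr hy

theorem IsResponse.vecOperator_eq {p : Type*} [Fintype p] {G : Matrix p m (RatFunc ℝ)}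
    {u : ℝ → m → ℝ} {y : ℝ → p → ℝ} (h : IsResponse G u y) :
    vecOperator y = act G (vecOperator u) := by
  obtain ⟨hu, K, rfl, x, hx, hy⟩ := h
  exact K.output_eq hu hx hy

end Signals

/-! ### Proper and stable rational functions -/

/-- Cross-multiplication with the reduced fraction preserves the degree difference, so properness
can be read off any representing fraction. -/
theorem RatFunc.degree_num_le_degree_denom {g : RatFunc ℝ} {p q : ℝ[X]} (hq : q ≠ 0)
    (h : g * algebraMap ℝ[X] (RatFunc ℝ) q = algebraMap ℝ[X] (RatFunc ℝ) p)
    (hpq : p.degree ≤ q.degree) : g.num.degree ≤ g.denom.degree := by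
  have hq' : algebraMap ℝ[X] (RatFunc ℝ) q ≠ 0 :=
    (map_ne_zero_iff _ (IsFractionRing.injective _ _)).2 hq
  have h1 : g.num * q = p * g.denom :=
    (RatFunc.num_mul_eq_mul_denom_iff hq).2 ((eq_div_iff hq').2 h)
  have h2 := congrArg Polynomial.degree h1
  rw [Polynomial.degree_mul, Polynomial.degree_mul, add_comm] at h2
  have h3 : q.degree + g.num.degree ≤ q.degree + g.denom.degree := by
    rw [h2]
    gcongr
  rw [Polynomial.degree_eq_natDegree hq, Polynomial.degree_eq_natDegree g.denom_ne_zero] at h3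
  rw [Polynomial.degree_eq_natDegree g.denom_ne_zero]
  by_cases hn : g.num = 0
  · simp [hn]
  · rw [Polynomial.degree_eq_natDegree hn] at h3 ⊢
    norm_cast at h3 ⊢
    omega

theorem exists_common_denominator {ι κ : Type*} [Finite ι] [Finite κ]
    (G : Matrix ι κ (RatFunc ℝ)) : ∃ d : ℝ[X], d ≠ 0 ∧ ∃ p : ι → κ → ℝ[X], ∀ i j,
      algebraMap ℝ[X] (RatFunc ℝ) d * G i j = algebraMap ℝ[X] (RatFunc ℝ) (p i j) := by
  obtain ⟨d, hd⟩ := IsLocalization.exist_integer_multiples_of_finite ℝ[X]⁰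
    (fun q : ι × κ => G q.1 q.2)
  choose p hp using hd
  refine ⟨d, nonZeroDivisors.ne_zero d.2, fun i j => p (i, j), fun i j => ?_⟩
  exact (Algebra.smul_def _ _).symm.trans (hp (i, j)).symm

/-- Take `c = d / (s + 1) ^ N`, with `d` a common denominator and `N` at least every numerator
degree. The only possible pole is then `-1`. A scalar factor does not affect whether a filter
isolates. -/
theorem exists_smul_isStableTransfer {k p : Type*} [Fintype k] [Fintype p]
    (G : Matrix k p (RatFunc ℝ)) : ∃ c : RatFunc ℝ, c ≠ 0 ∧ IsStableTransfer (c • G) := by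
  obtain ⟨d, hd, P, hP⟩ := exists_common_denominator G
  set N := ∑ i, ∑ j, (P i j).natDegree
  have hN : ∀ i j, (P i j).natDegree ≤ N := fun i j =>
    (Finset.single_le_sum (f := fun j => (P i j).natDegree) (fun _ _ => Nat.zero_le _)
      (Finset.mem_univ j)).trans
    (Finset.single_le_sum (f := fun i => ∑ j, (P i j).natDegree) (fun _ _ => Nat.zero_le _)
      (Finset.mem_univ i))
  set q : ℝ[X] := (Polynomial.X + Polynomial.C 1) ^ N
  have hqm : q.Monic := (Polynomial.monic_X_add_C 1).pow N
  have hqd : q.natDegree = N := by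
    rw [(Polynomial.monic_X_add_C (1 : ℝ)).natDegree_pow, Polynomial.natDegree_X_add_C, mul_one]
  have hinj := IsFractionRing.injective ℝ[X] (RatFunc ℝ)
  have hq : algebraMap ℝ[X] (RatFunc ℝ) q ≠ 0 := (map_ne_zero_iff _ hinj).2 hqm.ne_zero
  have hG : ∀ i j, ((algebraMap ℝ[X] (RatFunc ℝ) d / algebraMap ℝ[X] (RatFunc ℝ) q) • G) i j =
      algebraMap ℝ[X] (RatFunc ℝ) (P i j) / algebraMap ℝ[X] (RatFunc ℝ) q := by
    intro i j
    rw [Matrix.smul_apply, smul_eq_mul, ← hP, div_mul_eq_mul_div]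
  refine ⟨algebraMap ℝ[X] (RatFunc ℝ) d / algebraMap ℝ[X] (RatFunc ℝ) q,
    div_ne_zero ((map_ne_zero_iff _ hinj).2 hd) hq, fun i j => ?_, fun i j z hz => ?_⟩
  · refine RatFunc.degree_num_le_degree_denom hqm.ne_zero (p := P i j) ?_ ?_
    · rw [hG, div_mul_cancel₀ _ hq]
    · rw [Polynomial.degree_eq_natDegree hqm.ne_zero, hqd]
      exact Polynomial.degree_le_of_natDegree_le (hN i j)
  · rw [hG] at hz
    have h0 : Polynomial.aeval z q = 0 :=
      Polynomial.aeval_eq_zero_of_dvd_aeval_eq_zero (RatFunc.denom_div_dvd _ _) hz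
    have h1 : z + 1 = 0 := by
      have : (z + 1) ^ N = 0 := by simpa [q] using h0
      exact eq_zero_of_pow_eq_zero this
    rw [eq_neg_of_add_eq_zero_left h1]
    norm_num

/-! ### The rank condition -/

section Rank

variable {K : Type*} [Field K] {l m n : ℕ}

theorem range_mulVecLin_fromCols (A : Matrix (Fin l) (Fin m) K) (B : Matrix (Fin l) (Fin n) K) :
    LinearMap.range (Matrix.fromCols A B).mulVecLin =
      LinearMap.range A.mulVecLin ⊔ LinearMap.range B.mulVecLin := by
  ext z
  simp only [LinearMap.mem_range, Submodule.mem_sup, Matrix.mulVecLin_apply]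
  constructor
  · rintro ⟨w, rfl⟩
    exact ⟨_, ⟨w ∘ Sum.inl, rfl⟩, _, ⟨w ∘ Sum.inr, rfl⟩, (Matrix.fromCols_mulVec _ _ _).symm⟩
  · rintro ⟨_, ⟨u, rfl⟩, _, ⟨v, rfl⟩, rfl⟩
    exact ⟨Sum.elim u v, by rw [Matrix.fromCols_mulVec]; rfl⟩

/-- A dimension count makes `A` injective and its range disjoint from that of `B`. Hence `(u, b) ↦ A
u + b` is injective on `Kᵐ × range B`, and the first component of a left inverse is `S`. -/
theorem exists_mul_eq_one_of_rank_fromCols {A : Matrix (Fin l) (Fin m) K}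
    {B : Matrix (Fin l) (Fin n) K} (h : (Matrix.fromCols A B).rank = m + B.rank) :
    ∃ S : Matrix (Fin m) (Fin l) K, S * A = 1 ∧ S * B = 0 := by
  have hsum := Submodule.finrank_sup_add_finrank_inf_eq (LinearMap.range A.mulVecLin)
    (LinearMap.range B.mulVecLin)
  rw [← range_mulVecLin_fromCols] at hsum
  change (Matrix.fromCols A B).rank + _ = A.rank + B.rank at hsum
  have hA : A.rank ≤ m := by simpa using A.rank_le_card_width
  have hdis : Disjoint (LinearMap.range A.mulVecLin) (LinearMap.range B.mulVecLin) := by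
    rw [disjoint_iff]
    exact Submodule.finrank_eq_zero.1 (by omega)
  have hker : LinearMap.ker A.mulVecLin = ⊥ := by
    have := A.mulVecLin.finrank_range_add_finrank_ker
    change A.rank + _ = _ at this
    rw [Module.finrank_fin_fun] at this
    exact Submodule.finrank_eq_zero.1 (by omega)
  have hinj : LinearMap.ker
      (A.mulVecLin.coprod (LinearMap.range B.mulVecLin).subtype) = ⊥ := by
    rw [LinearMap.ker_coprod_of_disjoint_range _ _ (by rwa [Submodule.range_subtype]), hker,
      Submodule.ker_subtype, Submodule.prod_bot]
  obtain ⟨f, hf⟩ := LinearMap.exists_leftInverse_of_injective _ hinj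
  have hfA : ∀ u, f (A.mulVec u) = (u, 0) := fun u => by
    simpa using LinearMap.congr_fun hf (u, 0)
  have hfB : ∀ v, (f (B.mulVec v)).1 = 0 := fun v => by
    have := LinearMap.congr_fun hf (0, ⟨B.mulVec v, ⟨v, rfl⟩⟩)
    simpa using congrArg Prod.fst this
  refine ⟨LinearMap.toMatrix' (LinearMap.fst K _ _ ∘ₗ f), ?_, ?_⟩
  · refine Matrix.ext_of_mulVec_single fun i => ?_
    rw [← Matrix.mulVec_mulVec, LinearMap.toMatrix'_mulVec, LinearMap.comp_apply, hfA,
      Matrix.one_mulVec]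
    rfl
  · refine Matrix.ext_of_mulVec_single fun i => ?_
    rw [← Matrix.mulVec_mulVec, LinearMap.toMatrix'_mulVec, LinearMap.comp_apply,
      LinearMap.fst_apply, hfB, Matrix.zero_mulVec]

/-- `S` kills the range of `B` and `S A` is injective, so the two ranges meet trivially and `A` has
full column rank. -/
theorem rank_fromCols_of_mul {k : Type*} [Fintype k] {A : Matrix (Fin l) (Fin m) K}
    {B : Matrix (Fin l) (Fin n) K} (S : Matrix k (Fin l) K) (hB : S * B = 0)
    (hA : ∀ u, (S * A).mulVec u = 0 → u = 0) :
    (Matrix.fromCols A B).rank = m + B.rank := by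
  have hsum := Submodule.finrank_sup_add_finrank_inf_eq (LinearMap.range A.mulVecLin)
    (LinearMap.range B.mulVecLin)
  have hinf : LinearMap.range A.mulVecLin ⊓ LinearMap.range B.mulVecLin = ⊥ := by
    rw [eq_bot_iff]
    rintro _ ⟨⟨u, rfl⟩, ⟨v, hv⟩⟩
    rw [Matrix.mulVecLin_apply, Matrix.mulVecLin_apply] at hv
    have : u = 0 := hA u (by
      rw [← Matrix.mulVec_mulVec, ← hv, Matrix.mulVec_mulVec, hB, Matrix.zero_mulVec])
    simp [this]
  have hker : LinearMap.ker A.mulVecLin = ⊥ := by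
    rw [LinearMap.ker_eq_bot']
    intro u hu
    exact hA u (by rw [← Matrix.mulVec_mulVec, ← Matrix.mulVecLin_apply A, hu, Matrix.mulVec_zero])
  have hrank : A.rank = m := by
    have := A.mulVecLin.finrank_range_add_finrank_ker
    rw [hker, finrank_bot, add_zero, Module.finrank_fin_fun] at this
    exact this
  rw [hinf, finrank_bot, add_zero, ← range_mulVecLin_fromCols] at hsum
  change (Matrix.fromCols A B).rank = A.rank + B.rank at hsum
  rw [hsum, hrank]

end Rank

/-! ### The residual -/

namespace NetworkedSystem

variable {N : ℕ} (P : NetworkedSystem N)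

/-- `1 + C (s I - A)⁻¹ H`, which maps the residual `y - ŷ` of the observer with gain `H` to the
open-loop output. -/
noncomputable def openLoop (H : ∀ i, Matrix (Fin (P.nx i)) (Fin (P.ny i)) ℝ) (i : Fin N) :
    Matrix (Fin (P.ny i)) (Fin (P.ny i)) (RatFunc ℝ) :=
  transferMatrix (P.A i) (H i) (P.C i) 1

variable {P} {H : ∀ i, Matrix (Fin (P.nx i)) (Fin (P.ny i)) ℝ} {I : Finset (Fin N)}
  {r : ∀ i : I, ℝ → Fin (P.nr i) → ℝ} {a : ∀ i : I, ℝ → Fin (P.na i) → ℝ}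
  {x : ∀ i : I, ℝ → Fin (P.nx i) → ℝ} {v : ∀ i : I, ℝ → Fin (P.nv i) → ℝ}
  {w : ∀ i : I, ℝ → Fin (P.nw i) → ℝ} {y : ∀ i : I, ℝ → Fin (P.ny i) → ℝ}
  {xh χh : ∀ i : I, ℝ → Fin (P.nx i) → ℝ} {vh : ∀ i : I, ℝ → Fin (P.nv i) → ℝ}
  {wh : ∀ i : I, ℝ → Fin (P.nw i) → ℝ} {yh : ∀ i : I, ℝ → Fin (P.ny i) → ℝ}

/-- The references cancel in `e = x - x̂`, leaving `s e = A e + U (v - v̂) + X a - H η`. Solve for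
`e`, insert it in `η = C e + V (v - v̂) + Y a` and move the `H` term to the left. Neither the
rectifier nor the interconnection enters, which is why one filter serves every `I`. -/
theorem act_openLoop_residual (h : P.IsTrajectory I r a x v w y)
    (ho : P.IsObserverTrajectory H I r y xh χh vh wh yh) (i : I) :
    act (P.openLoop H i) (vecOperator fun t => y i t - yh i t) =
      act (P.Gyv i) (vecOperator fun t => v i t - vh i t) + act (P.Gya i) (vecOperator (a i)) := by
  have hr := h.signal_r i
  have ha := h.signal_a i
  have hv := h.signal_v i
  have hvh := ho.signal_v i
  have hx := (h.state i).isSignal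
  have hxh := (ho.state i).isSignal
  have sy := (((hx.mulVec (P.C i)).add (hr.mulVec (P.D i))).add (hv.mulVec (P.V i))).add
    (ha.mulVec (P.Y i))
  have syh := ((hxh.mulVec (P.C i)).add (hr.mulVec (P.D i))).add (hvh.mulVec (P.V i))
  have hy := sy.congr (h.output i)
  have hyh := syh.congr (ho.output i)
  have hη := hy.sub hyh
  have ey := vecOperator_congr sy (h.output i)
  have eyh := vecOperator_congr syh (ho.output i)
  have ex := (h.state i).X_smul_vecOperator
    (((hr.mulVec (P.B i)).add (hv.mulVec (P.U i))).add (ha.mulVec (P.X i)))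
  have exh := (ho.state i).X_smul_vecOperator
    (((hr.mulVec (P.B i)).add (hvh.mulVec (P.U i))).add (hη.mulVec (H i)))
  rw [vecOperator_add (((hx.mulVec (P.C i)).add (hr.mulVec (P.D i))).add (hv.mulVec (P.V i)))
      (ha.mulVec (P.Y i)), vecOperator_add ((hx.mulVec (P.C i)).add (hr.mulVec (P.D i)))
      (hv.mulVec (P.V i)), vecOperator_add (hx.mulVec (P.C i)) (hr.mulVec (P.D i)),
    vecOperator_mulVec hx, vecOperator_mulVec hr, vecOperator_mulVec hv,
    vecOperator_mulVec ha] at ey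
  rw [vecOperator_add ((hxh.mulVec (P.C i)).add (hr.mulVec (P.D i))) (hvh.mulVec (P.V i)),
    vecOperator_add (hxh.mulVec (P.C i)) (hr.mulVec (P.D i)),
    vecOperator_mulVec hxh, vecOperator_mulVec hr, vecOperator_mulVec hvh] at eyh
  rw [vecOperator_add ((hr.mulVec (P.B i)).add (hv.mulVec (P.U i))) (ha.mulVec (P.X i)),
    vecOperator_add (hr.mulVec (P.B i)) (hv.mulVec (P.U i)),
    vecOperator_mulVec hr, vecOperator_mulVec hv, vecOperator_mulVec ha] at ex
  rw [vecOperator_add ((hr.mulVec (P.B i)).add (hvh.mulVec (P.U i))) (hη.mulVec (H i)),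
    vecOperator_add (hr.mulVec (P.B i)) (hvh.mulVec (P.U i)),
    vecOperator_mulVec hr, vecOperator_mulVec hvh, vecOperator_mulVec hη] at exh
  have eη := vecOperator_sub hy hyh
  have ee : (RatFunc.X : RatFunc ℝ) • (vecOperator (x i) - vecOperator (xh i)) =
      act ((P.A i).map RatFunc.C) (vecOperator (x i) - vecOperator (xh i)) +
        (act ((P.U i).map RatFunc.C) (vecOperator (v i) - vecOperator (vh i)) +
          act ((P.X i).map RatFunc.C) (vecOperator (a i)) -
          act ((H i).map RatFunc.C) (vecOperator fun t => y i t - yh i t)) := by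
    rw [smul_sub, ex, exh, act_sub, act_sub]
    abel
  have ee' := eq_resolvent_act ee
  rw [openLoop, Gyv, Gya, transferMatrix_act, transferMatrix_act, transferMatrix_act,
    vecOperator_sub hv hvh]
  have h1 : (1 : Matrix (Fin (P.ny i)) (Fin (P.ny i)) ℝ).map RatFunc.C = 1 :=
    Matrix.map_one _ (map_zero _) (map_one _)
  rw [act_sub, act_add] at ee'
  rw [h1, one_act]
  -- Only the bare `η` is expanded; the one behind `H` has to survive on the left.
  nth_rw 2 [eη]
  rw [ey, eyh]
  have ec := congrArg (act ((P.C i).map RatFunc.C)) ee'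
  rw [act_sub, act_sub, act_add, sub_eq_iff_eq_add] at ec
  rw [ec, act_sub ((P.V i).map RatFunc.C)]
  abel

theorem isolates_of_mul_eq {i : I} {k : ℕ} {S : Matrix (Fin k) (Fin (P.ny i)) (RatFunc ℝ)}
    {T : Matrix (Fin k) (Fin (P.ny i)) (RatFunc ℝ)} (hS : S = T * P.openLoop H i)
    (hv : T * P.Gyv i = 0) {R : Matrix (Fin (P.na i)) (Fin k) (RatFunc ℝ)}
    (ha : R * (T * P.Gya i) = 1) : P.Isolates H I i S := by
  intro r a x v w y xh χh vh wh yh h ho ε hε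
  have e : vecOperator ε = act (T * P.Gya i) (vecOperator (a i)) := by
    rw [hε.vecOperator_eq, hS, act_mul, act_openLoop_residual h ho, act_add, ← act_mul, hv,
      zero_act, zero_add, ← act_mul]
  rw [not_iff_not, ← vecOperator_eq_zero_iff hε.isSignal, ← vecOperator_eq_zero_iff (h.signal_a i)]
  constructor
  · intro h0
    rw [← one_act (vecOperator (a i)), ← ha, act_mul, ← e, h0, act_zero]
  · intro h0
    rw [e, h0, act_zero]

theorem exists_isolating_filter {i : Fin N} (h : P.LocalRankCondition i)
    (H : ∀ i, Matrix (Fin (P.nx i)) (Fin (P.ny i)) ℝ) :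
    ∃ (k : ℕ) (S : Matrix (Fin k) (Fin (P.ny i)) (RatFunc ℝ)), IsStableTransfer S ∧
      ∀ (I : Finset (Fin N)) (hi : i ∈ I), P.Isolates H I ⟨i, hi⟩ S := by
  obtain ⟨T, hTa, hTv⟩ := exists_mul_eq_one_of_rank_fromCols h
  obtain ⟨c, hc, hs⟩ := exists_smul_isStableTransfer (T * P.openLoop H i)
  refine ⟨P.na i, _, hs, fun I hi => ?_⟩
  refine isolates_of_mul_eq (T := c • T) (R := c⁻¹ • 1) (by rw [Matrix.smul_mul]) ?_ ?_
  · rw [Matrix.smul_mul, hTv, smul_zero]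
  · rw [Matrix.smul_mul, Matrix.smul_mul, Matrix.mul_smul, hTa, smul_smul,
    Matrix.mul_one, inv_mul_cancel₀ hc, one_smul]

end NetworkedSystem

/-! ### Realization of proper transfer matrices -/

theorem transferMatrix_reindex {n n' m p : Type*} [Fintype n] [DecidableEq n] [Fintype n']
    [DecidableEq n'] (e : n' ≃ n) (A : Matrix n n ℝ) (B : Matrix n m ℝ) (C : Matrix p n ℝ)
    (D : Matrix p m ℝ) :
    transferMatrix (A.submatrix e e) (B.submatrix e id) (C.submatrix id e) D =
      transferMatrix A B C D := by
  have h : Matrix.scalar n' (RatFunc.X : RatFunc ℝ) - (A.submatrix e e).map RatFunc.C =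
      (Matrix.scalar n RatFunc.X - A.map RatFunc.C).submatrix e e := by
    ext i j
    simp [Matrix.diagonal_apply]
  rw [transferMatrix, h, Matrix.inv_submatrix_equiv, ← Matrix.submatrix_map,
    ← Matrix.submatrix_map, Matrix.submatrix_mul_equiv, Matrix.submatrix_mul_equiv,
    Matrix.submatrix_id_id]
  rfl

theorem StateSpace.exists_transfer_eq {n m p : Type*} [Fintype n] [DecidableEq n]
    (A : Matrix n n ℝ) (B : Matrix n m ℝ) (C : Matrix p n ℝ) (D : Matrix p m ℝ) :
    ∃ K : StateSpace m p, K.transfer = transferMatrix A B C D :=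
  ⟨⟨Fintype.card n, A.submatrix (Fintype.equivFin n).symm (Fintype.equivFin n).symm,
    B.submatrix (Fintype.equivFin n).symm id, C.submatrix id (Fintype.equivFin n).symm, D⟩,
    transferMatrix_reindex (Fintype.equivFin n).symm A B C D⟩

/-- The equation for `Ξ` determines it as `(s - A)⁻¹ B`, so a realization can be checked without
inverting the pencil. -/
theorem transferMatrix_eq_of_state {n m p : Type*} [Fintype n] [DecidableEq n]
    {A : Matrix n n ℝ} {B : Matrix n m ℝ} {C : Matrix p n ℝ} {D : Matrix p m ℝ}
    {Ξ : Matrix n m (RatFunc ℝ)} {G : Matrix p m (RatFunc ℝ)}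
    (hΞ : (RatFunc.X : RatFunc ℝ) • Ξ = A.map RatFunc.C * Ξ + B.map RatFunc.C)
    (hG : G = C.map RatFunc.C * Ξ + D.map RatFunc.C) : transferMatrix A B C D = G := by
  have h : B.map RatFunc.C = (Matrix.scalar n RatFunc.X - A.map RatFunc.C) * Ξ := by
    rw [Matrix.sub_mul, Matrix.scalar_apply, ← Matrix.smul_eq_diagonal_mul, hΞ]
    simp
  rw [transferMatrix, h, Matrix.mul_assoc, ← Matrix.mul_assoc _ _ Ξ,
    Matrix.nonsing_inv_mul _ ((Matrix.isUnit_iff_isUnit_det _).1 (isUnit_pencil A)),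
    Matrix.one_mul, hG]

theorem algebraMap_div_eq_sum {p d : ℝ[X]} {n : ℕ} (hp : p.natDegree ≤ n) :
    algebraMap ℝ[X] (RatFunc ℝ) p / algebraMap ℝ[X] (RatFunc ℝ) d =
      ∑ l : Fin n, RatFunc.C (p.coeff l) *
        (RatFunc.X ^ (l : ℕ) / algebraMap ℝ[X] (RatFunc ℝ) d) +
      RatFunc.C (p.coeff n) * (RatFunc.X ^ n / algebraMap ℝ[X] (RatFunc ℝ) d) := by
  rw [Finset.sum_fin_eq_sum_range, Finset.sum_congr rfl (g := fun l => RatFunc.C (p.coeff l) *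
      (RatFunc.X ^ l / algebraMap ℝ[X] (RatFunc ℝ) d))
      (fun l hl => by rw [dif_pos (Finset.mem_range.1 hl)]),
    ← Finset.sum_range_succ (f := fun l => RatFunc.C (p.coeff l) *
      (RatFunc.X ^ l / algebraMap ℝ[X] (RatFunc ℝ) d))]
  conv_lhs => rw [p.as_sum_range_C_mul_X_pow' (Nat.lt_succ_of_le hp)]
  rw [map_sum, Finset.sum_div]
  refine Finset.sum_congr rfl fun l _ => ?_
  rw [map_mul, map_pow, RatFunc.algebraMap_C, RatFunc.algebraMap_X, mul_div_assoc]

/-- Controllable canonical form: every proper transfer matrix has a state-space realization. -/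
theorem IsProper.exists_realization {k p : Type*} [Fintype k] [Fintype p]
    {G : Matrix k p (RatFunc ℝ)} (hG : IsProper G) : ∃ K : StateSpace p k, K.transfer = G := by
  classical
  obtain ⟨d, hd, Pm, hP⟩ := exists_common_denominator G
  set n := d.natDegree with hn
  have hlc : d.coeff n ≠ 0 := by
    rwa [hn, Polynomial.coeff_natDegree, Polynomial.leadingCoeff_ne_zero]
  have hd' : algebraMap ℝ[X] (RatFunc ℝ) d ≠ 0 :=
    (map_ne_zero_iff _ (IsFractionRing.injective _ _)).2 hd
  have hGP : ∀ i j, G i j = algebraMap ℝ[X] (RatFunc ℝ) (Pm i j) /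
      algebraMap ℝ[X] (RatFunc ℝ) d := fun i j => by
    rw [← hP, mul_div_cancel_left₀ _ hd']
  -- Properness concerns the reduced fraction; it passes to `Pm i j / d` by comparing degrees.
  have hdeg : ∀ i j, (Pm i j).natDegree ≤ n := by
    intro i j
    by_cases h0 : Pm i j = 0
    · simp [h0]
    have h1 : (G i j).num * d = Pm i j * (G i j).denom :=
      (RatFunc.num_mul_eq_mul_denom_iff hd).2 (hGP i j)
    have hnum : (G i j).num ≠ 0 := by
      intro h
      rw [h, zero_mul] at h1
      exact mul_ne_zero h0 (G i j).denom_ne_zero h1.symm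
    have h2 := congrArg Polynomial.natDegree h1
    rw [Polynomial.natDegree_mul hnum hd,
      Polynomial.natDegree_mul h0 (G i j).denom_ne_zero] at h2
    have h3 := Polynomial.natDegree_le_natDegree (hG i j)
    omega
  -- The states are `s ^ l / d` for `l < n`, one copy for each input. Multiplication by `s` shifts
  -- them.
  set φ : ℕ → RatFunc ℝ := fun l => RatFunc.X ^ l / algebraMap ℝ[X] (RatFunc ℝ) d
  have hφ : ∀ l, RatFunc.X * φ l = φ (l + 1) := fun l => by
    simp only [φ]
    rw [pow_succ', mul_div_assoc]
  have hlc' : RatFunc.C (d.coeff n) ≠ 0 := (map_ne_zero _).2 hlc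
  -- Dividing the expansion of `d` by `d` expresses `s ^ n / d` through the states and a constant.
  -- This gives the last companion row, the input matrix and the feedthrough.
  have hφn : φ n = RatFunc.C (d.coeff n)⁻¹ +
      ∑ l : Fin n, RatFunc.C (-(d.coeff l / d.coeff n)) * φ l := by
    have h := algebraMap_div_eq_sum (d := d) (le_refl d.natDegree)
    rw [div_self hd', ← hn] at h
    have : ∑ l : Fin n, RatFunc.C (-(d.coeff l / d.coeff n)) * φ l =
        -(RatFunc.C (d.coeff n))⁻¹ * ∑ l : Fin n, RatFunc.C (d.coeff l) * φ l := by
      rw [Finset.mul_sum]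
      refine Finset.sum_congr rfl fun l _ => ?_
      rw [map_neg, map_div₀]
      ring
    rw [this, map_inv₀]
    have h' : ∑ l : Fin n, RatFunc.C (d.coeff l) * φ l = 1 - RatFunc.C (d.coeff n) * φ n :=
      eq_sub_of_add_eq h.symm
    rw [h']
    field_simp
    ring
  let A₀ : Matrix (Fin n) (Fin n) ℝ := fun l l' =>
    if (l : ℕ) + 1 = n then -(d.coeff l' / d.coeff n) else if (l' : ℕ) = l + 1 then 1 else 0
  let A : Matrix (Fin n × p) (Fin n × p) ℝ := Matrix.of fun q q' =>
    if q.2 = q'.2 then A₀ q.1 q'.1 else 0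
  let B : Matrix (Fin n × p) p ℝ := Matrix.of fun q j =>
    if q.2 = j then (if (q.1 : ℕ) + 1 = n then (d.coeff n)⁻¹ else 0) else 0
  let C : Matrix k (Fin n × p) ℝ := Matrix.of fun i q =>
    (Pm i q.2).coeff q.1 + (Pm i q.2).coeff n * (-(d.coeff q.1 / d.coeff n))
  let D : Matrix k p ℝ := Matrix.of fun i j => (Pm i j).coeff n * (d.coeff n)⁻¹
  let Ξ : Matrix (Fin n × p) p (RatFunc ℝ) := Matrix.of fun q j => if q.2 = j then φ q.1 else 0
  have hA₀ : ∀ l : Fin n, φ (l + 1) = ∑ l' : Fin n, RatFunc.C (A₀ l l') * φ l' +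
      RatFunc.C (if (l : ℕ) + 1 = n then (d.coeff n)⁻¹ else 0) := by
    intro l
    by_cases hl : (l : ℕ) + 1 = n
    · simp only [A₀, if_pos hl]
      rw [hl, hφn, add_comm]
    · have hlt : (l : ℕ) + 1 < n := lt_of_le_of_ne l.2 hl
      simp only [A₀, if_neg hl]
      rw [Finset.sum_eq_single ⟨l + 1, hlt⟩]
      · simp
      · intro l' _ hl'
        rw [if_neg (fun h => hl' (Fin.ext h)), map_zero, zero_mul]
      · simp
  obtain ⟨K, hK⟩ := StateSpace.exists_transfer_eq A B C D
  refine ⟨K, hK.trans (transferMatrix_eq_of_state (Ξ := Ξ) ?_ ?_)⟩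
  · ext q j
    simp only [Matrix.smul_apply, smul_eq_mul, Matrix.add_apply, Matrix.mul_apply,
      Matrix.map_apply, Matrix.of_apply, Fintype.sum_prod_type,
      A, B, Ξ, apply_ite RatFunc.C, map_zero, mul_ite, ite_mul, zero_mul, mul_zero, Finset.sum_ite_eq',
      Finset.mem_univ, if_true]
    by_cases hq : q.2 = j
    · simp only [if_pos hq]
      rw [hφ, hA₀, apply_ite RatFunc.C, map_zero]
    · simp [if_neg hq]
  · ext i j
    simp only [Matrix.add_apply, Matrix.mul_apply, Matrix.map_apply, Matrix.of_apply, Fintype.sum_prod_type,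
      C, D, Ξ, mul_ite, mul_zero, Finset.sum_ite_eq', Finset.mem_univ, if_true]
    rw [hGP, algebraMap_div_eq_sum (hdeg i j)]
    change _ + RatFunc.C ((Pm i j).coeff n) * φ n = _
    rw [hφn, mul_add, Finset.mul_sum, add_left_comm, ← Finset.sum_add_distrib, add_comm,
      ← map_mul]
    congr 1
    refine Finset.sum_congr rfl fun l _ => ?_
    rw [map_add, map_mul, add_mul, mul_assoc]

/-! ### Signals with rational transforms -/

theorem exists_continuous_solution {n : Type*} [Fintype n] (A : Matrix n n ℝ) (b : n → ℝ) :
    ∃ x : ℝ → n → ℝ, Continuous x ∧ ∀ t, x t = b + ∫ s in (0 : ℝ)..t, A.mulVec (x s) := by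
  let T : (n → ℝ) →L[ℝ] (n → ℝ) := LinearMap.toContinuousLinearMap A.mulVecLin
  let x : ℝ → n → ℝ := fun t => NormedSpace.exp (t • T) b
  have hd : ∀ t, HasDerivAt x (A.mulVec (x t)) t := fun t =>
    ((ContinuousLinearMap.apply ℝ (n → ℝ) b).hasFDerivAt.comp_hasDerivAt t
      (hasDerivAt_exp_smul_const' (𝕂 := ℝ) T t))
  have hc : Continuous x := continuous_iff_continuousAt.2 fun t => (hd t).continuousAt
  refine ⟨x, hc, fun t => ?_⟩
  rw [intervalIntegral.integral_eq_sub_of_hasDerivAt (fun s _ => hd s)]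
  · simp [x]
  · exact (T.continuous.comp hc).intervalIntegrable _ _

/-- The scalar multiples of a fixed operator. -/
noncomputable def tensor {n : Type*} (g : n → RatFunc ℝ) (e : OperatorSpace) :
    n → OperatorSpace :=
  fun j => g j • e

/-- The function `exp (t A) b` satisfies `x = b + ∫ A x`, that is, `s x = A x + s b`. Since `s •
embed 1` plays the part of the Dirac impulse, this is an impulse response. -/
theorem exists_embed_exp {n : Type*} [Fintype n] [DecidableEq n] (A : Matrix n n ℝ) (b : n → ℝ) :
    ∃ F : n → C(ℝ≥0, ℝ), (fun j => embed (F j)) =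
      act (Matrix.scalar n RatFunc.X - A.map RatFunc.C)⁻¹
        ((RatFunc.X : RatFunc ℝ) • fun j => RatFunc.C (b j) • embed 1) := by
  obtain ⟨x, hc, hx⟩ := exists_continuous_solution A b
  have hcj : ∀ j, Continuous fun t => x t j := fun j => (continuous_apply j).comp hc
  let F : n → C(ℝ≥0, ℝ) := fun j => ⟨fun t => x t j, (hcj j).comp NNReal.continuous_coe⟩
  have hxs : IsSignal x := isSignal_of_continuousOn hc.continuousOn
  have hAx := hxs.mulVec A
  have e1 : vecOperator x = fun j => embed (F j) := by
    rw [← vecOperator_vecExtend]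
    refine vecOperator_congr (isSignal_vecExtend F) ?_
    refine (ae_restrict_iff' measurableSet_Ici).2 (ae_of_all _ fun t ht => ?_)
    ext j
    simp [vecExtend, extendConst, F, Real.coe_toNNReal t ht]
  refine ⟨F, ?_⟩
  rw [← e1]
  refine eq_resolvent_act ?_
  rw [← vecOperator_mulVec hxs]
  ext j
  have hone : operator (fun _ => b j) = RatFunc.C (b j) • embed 1 := by
    rw [← embed_smul, ← operator_extendConst]
    congr 1
    ext t
    simp [extendConst]
  have hz : IsScalarSignal fun t => ∫ s in (0 : ℝ)..t, A.mulVec (x s) j :=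
    (intervalIntegral.continuous_primitive (fun a c =>
      ((continuous_apply j).comp
        ((LinearMap.continuous_of_finiteDimensional A.mulVecLin).comp hc)).intervalIntegrable a c)
      0).locallyIntegrable.locallyIntegrableOn _
  have e2 : vecOperator x j = RatFunc.C (b j) • embed 1 +
      (RatFunc.X : RatFunc ℝ)⁻¹ • vecOperator (fun t => A.mulVec (x t)) j := by
    rw [← hone, vecOperator, vecOperator, ← operator_eq_inv_X_smul (hAx.eval j) hz fun _ _ => rfl,
      ← operator_add (continuous_const.locallyIntegrable.locallyIntegrableOn _) hz]
    refine operator_congr (hxs.eval j)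
      (LocallyIntegrableOn.add (continuous_const.locallyIntegrable.locallyIntegrableOn _) hz) ?_
    refine (ae_restrict_iff' measurableSet_Ici).2 (ae_of_all _ fun t ht => ?_)
    conv_lhs => rw [hx t]
    rw [Pi.add_apply, integral_apply_of_isSignal hAx ht]
  rw [Pi.smul_apply, e2, smul_add, smul_inv_smul₀
    (show (RatFunc.X : RatFunc ℝ) ≠ 0 from RatFunc.X_ne_zero), add_comm]
  rfl

/-- This is the step response: a realization of `g` gives the integral of `C exp (t A) B`, plus the
constant `D`. -/
theorem exists_embed_eq_of_proper {g : RatFunc ℝ} (hg : g.num.degree ≤ g.denom.degree) :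
    ∃ f : C(ℝ≥0, ℝ), embed f = g • embed 1 := by
  obtain ⟨K, hK⟩ := IsProper.exists_realization (k := Unit) (p := Unit) (G := fun _ _ => g)
    fun _ _ => hg
  obtain ⟨F, hF⟩ := exists_embed_exp K.A (fun j => K.B j ())
  refine ⟨integration (∑ j, K.C () j • F j) + K.D () () • 1, ?_⟩
  have hsum : embed (∑ j, K.C () j • F j) =
      act (K.C.map RatFunc.C) (fun j => embed (F j)) () := by
    have := map_sum (AddMonoidHom.mk' embed embed_add) (fun j => K.C () j • F j) Finset.univ
    refine this.trans (Finset.sum_congr rfl fun j _ => ?_)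
    exact embed_smul _ _
  have hB : (fun j => RatFunc.C (K.B j ()) • embed 1) =
      act (K.B.map RatFunc.C) (fun _ => embed 1) := by
    ext j
    simp [act]
  have hg' : g • embed 1 = act K.transfer (fun _ => embed 1) () := by
    rw [hK]
    simp [act]
  rw [hg', StateSpace.transfer, transferMatrix_act, embed_add, embed_integration, hsum, hF,
    embed_smul, act_smul, act_smul, Pi.smul_apply, smul_smul, inv_mul_cancel₀ RatFunc.X_ne_zero,
    one_smul, hB, Pi.add_apply]
  simp [act]

/-- Division by `s ^ k` makes all entries proper once `k` reaches their numerator degrees. The form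
with `∀ᶠ` lets several vectors share one `k`. -/
theorem eventually_exists_embed_eq {ι : Type*} [Finite ι] (g : ι → RatFunc ℝ) :
    ∀ᶠ k : ℕ in atTop, ∃ F : ι → C(ℝ≥0, ℝ), (fun j => embed (F j)) =
      tensor g (((RatFunc.X : RatFunc ℝ)⁻¹ ^ k) • embed 1) := by
  have h : ∀ᶠ k : ℕ in atTop, ∀ j, ∃ f : C(ℝ≥0, ℝ),
      embed f = g j • ((RatFunc.X : RatFunc ℝ)⁻¹ ^ k) • embed 1 := by
    refine eventually_all.2 fun j => ?_
    filter_upwards [eventually_ge_atTop (g j).num.natDegree] with k hk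
    rw [smul_smul]
    refine exists_embed_eq_of_proper
      (RatFunc.degree_num_le_degree_denom (p := (g j).num) (q := (g j).denom * Polynomial.X ^ k)
        (mul_ne_zero (g j).denom_ne_zero (pow_ne_zero _ Polynomial.X_ne_zero)) ?_ ?_)
    · have hX : (RatFunc.X : RatFunc ℝ) ≠ 0 := RatFunc.X_ne_zero
      have hden : algebraMap ℝ[X] (RatFunc ℝ) (g j).denom ≠ 0 :=
        (map_ne_zero_iff _ (IsFractionRing.injective _ _)).2 (g j).denom_ne_zero
      rw [map_mul, map_pow, RatFunc.algebraMap_X]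
      nth_rw 1 [← RatFunc.num_div_denom (g j)]
      rw [inv_pow]
      field_simp
    · rw [Polynomial.degree_mul, Polynomial.degree_X_pow,
        Polynomial.degree_eq_natDegree (g j).denom_ne_zero]
      refine Polynomial.degree_le_natDegree.trans ?_
      norm_cast
      omega
  filter_upwards [h] with k hk
  choose F hF using hk
  exact ⟨F, funext hF⟩

/-! ### Rational multiples of one operator -/

section Tensor

variable {m n : Type*}

theorem tensor_add (g h : n → RatFunc ℝ) (e : OperatorSpace) :
    tensor g e + tensor h e = tensor (g + h) e := by
  ext j
  exact (add_smul (g j) (h j) e).symm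

theorem tensor_sub (g h : n → RatFunc ℝ) (e : OperatorSpace) :
    tensor g e - tensor h e = tensor (g - h) e := by
  ext j
  exact (sub_smul (g j) (h j) e).symm

theorem smul_tensor (c : RatFunc ℝ) (g : n → RatFunc ℝ) (e : OperatorSpace) :
    c • tensor g e = tensor (c • g) e := by
  ext j
  exact smul_smul c (g j) e

theorem act_tensor [Fintype n] (G : Matrix m n (RatFunc ℝ)) (g : n → RatFunc ℝ)
    (e : OperatorSpace) : act G (tensor g e) = tensor (G.mulVec g) e :=
  act_smul_const G g e

theorem tensor_eq_zero_iff {g : n → RatFunc ℝ} {e : OperatorSpace} (he : e ≠ 0) :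
    tensor g e = 0 ↔ g = 0 := by
  simp only [funext_iff, tensor, Pi.zero_apply, smul_eq_zero, he, or_false]

end Tensor

theorem blockDiagonal'_mulVec_apply {ι R : Type*} [Fintype ι] [DecidableEq ι] [CommSemiring R]
    {m n : ι → Type*} [∀ i, Fintype (n i)] (M : ∀ i, Matrix (m i) (n i) R)
    (u : (Σ i, n i) → R) (i : ι) (k : m i) :
    (Matrix.blockDiagonal' M).mulVec u ⟨i, k⟩ = (M i).mulVec (fun l => u ⟨i, l⟩) k := by
  rw [Matrix.mulVec, dotProduct, Fintype.sum_sigma, Finset.sum_eq_single i]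
  · simp [Matrix.mulVec, dotProduct, Matrix.blockDiagonal'_apply_eq]
  · intro j _ hj
    refine Finset.sum_eq_zero fun l _ => ?_
    rw [Matrix.blockDiagonal'_apply_ne _ _ _ hj.symm, zero_mul]
  · simp

theorem isResponse_of_tensor {m p : Type*} [Fintype m] [Fintype p] (K : StateSpace m p)
    {u : ℝ → m → ℝ} {y : ℝ → p → ℝ} {Z : Fin K.order → C(ℝ≥0, ℝ)} {g : m → RatFunc ℝ}
    {e : OperatorSpace} (hu : IsSignal u) (hy : IsSignal y) (eu : vecOperator u = tensor g e)
    (eZ : (fun j => embed (Z j)) = tensor ((Matrix.scalar _ RatFunc.X - K.A.map RatFunc.C)⁻¹.mulVec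
      ((K.B.map RatFunc.C).mulVec g)) e)
    (ey : vecOperator y = tensor (K.transfer.mulVec g) e) : IsResponse K.transfer u y := by
  have hZ := isSignal_vecExtend Z
  have hs : IsStateTrajectory K.A (fun t => K.B.mulVec (u t)) (vecExtend Z) := by
    refine isStateTrajectory_vecExtend (hu.mulVec K.B) ?_
    rw [vecOperator_vecExtend, eZ, vecOperator_mulVec hu, eu, act_tensor, act_tensor, tensor_add,
      smul_tensor, X_smul_resolvent_mulVec]
  refine ⟨hu, K, rfl, vecExtend Z, hs, ?_⟩
  have hout := (hZ.mulVec K.C).add (hu.mulVec K.D)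
  refine ae_eq_of_vecOperator_eq hy hout ?_
  rw [K.output_eq hu hs (ae_of_all _ fun _ => rfl), ey, eu, act_tensor]

theorem isStateTrajectory_zero {n : Type*} [Fintype n] (A : Matrix n n ℝ) :
    IsStateTrajectory A (fun _ => 0) (fun _ => 0) :=
  ⟨continuousOn_const, fun t _ => by simp⟩

theorem isResponse_zero {m p : Type*} [Fintype m] (K : StateSpace m p) :
    IsResponse K.transfer (fun _ => 0) (fun _ => 0) := by
  refine ⟨isSignal_zero, K, rfl, fun _ => 0, ?_, ae_of_all _ fun t => ?_⟩
  · simpa using isStateTrajectory_zero K.A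
  · simp

/-! ### Trajectories for rational attacks and necessity of the rank condition -/

namespace NetworkedSystem

variable {N : ℕ} (P : NetworkedSystem N) (H : ∀ i, Matrix (Fin (P.nx i)) (Fin (P.ny i)) ℝ)

/-- By Sylvester's identity, `det (1 + C R H) = det (1 + R H C)` with `R = (s - A)⁻¹`.
Multiplication by `det (s - A)` gives the characteristic polynomial of `A - H C`, which is nonzero.
-/
theorem isUnit_openLoop (i : Fin N) : IsUnit (P.openLoop H i) := by
  set R := (Matrix.scalar (Fin (P.nx i)) (RatFunc.X : RatFunc ℝ) - (P.A i).map RatFunc.C)⁻¹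
  have h1 : (1 : Matrix (Fin (P.ny i)) (Fin (P.ny i)) ℝ).map RatFunc.C = 1 :=
    Matrix.map_one _ (map_zero _) (map_one _)
  have h2 : (Matrix.scalar (Fin (P.nx i)) (RatFunc.X : RatFunc ℝ) - (P.A i).map RatFunc.C) *
      (1 + R * (H i).map RatFunc.C * (P.C i).map RatFunc.C) =
      Matrix.scalar (Fin (P.nx i)) RatFunc.X - (P.A i - H i * P.C i).map RatFunc.C := by
    rw [Matrix.mul_add, Matrix.mul_one, Matrix.mul_assoc R, ← Matrix.mul_assoc _ R,
      Matrix.mul_nonsing_inv _ ((Matrix.isUnit_iff_isUnit_det _).1 (isUnit_pencil (P.A i))),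
      Matrix.one_mul, Matrix.map_sub _ (map_sub _), Matrix.map_mul]
    abel
  have h3 := isUnit_pencil (P.A i - H i * P.C i)
  rw [← h2, Matrix.isUnit_iff_isUnit_det, Matrix.det_mul] at h3
  rw [Matrix.isUnit_iff_isUnit_det, openLoop, transferMatrix, h1, Matrix.mul_assoc, add_comm,
    Matrix.det_one_add_mul_comm]
  exact isUnit_of_mul_isUnit_right h3

variable {P} {I : Finset (Fin N)}

/-- The interaction caused by the attack with transform `α`. -/
noncomputable def inflow (P : NetworkedSystem N) (I : Finset (Fin N))
    (α : (Σ j : I, Fin (P.na j)) → RatFunc ℝ) : (Σ j : I, Fin (P.nv j)) → RatFunc ℝ :=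
  (P.Q I * Matrix.blockDiagonal' (fun j : I => P.Gwa j)).mulVec α

/-- Take `ω = loop⁻¹ diag(G_wa) α`; the loop equation rearranges to `w = G_wv v + G_wa a` at each
subsystem. -/
theorem exists_outflow (hI : IsUnit (P.loop I)) (α : (Σ j : I, Fin (P.na j)) → RatFunc ℝ) :
    ∃ ω : (Σ j : I, Fin (P.nw j)) → RatFunc ℝ, (P.LSub I).mulVec ω = P.inflow I α ∧
      ∀ j : I, (fun l => ω ⟨j, l⟩) = (P.Gwv j).mulVec (fun l => P.inflow I α ⟨j, l⟩) +
        (P.Gwa j).mulVec (fun l => α ⟨j, l⟩) := by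
  set b := (Matrix.blockDiagonal' (fun j : I => P.Gwa j)).mulVec α
  have h1 : (P.LSub I).mulVec ((P.loop I)⁻¹.mulVec b) = P.inflow I α := by
    rw [inflow, Q, Matrix.mul_assoc, ← Matrix.mulVec_mulVec, ← Matrix.mulVec_mulVec]
  have h2 : (P.loop I).mulVec ((P.loop I)⁻¹.mulVec b) = b := by
    rw [Matrix.mulVec_mulVec, Matrix.mul_nonsing_inv _ ((Matrix.isUnit_iff_isUnit_det _).1 hI),
      Matrix.one_mulVec]
  refine ⟨(P.loop I)⁻¹.mulVec b, h1, fun j => ?_⟩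
  nth_rw 1 [loop] at h2
  rw [Matrix.sub_mulVec, Matrix.one_mulVec, ← Matrix.mulVec_mulVec, h1, sub_eq_iff_eq_add'] at h2
  ext l
  rw [Pi.add_apply, ← blockDiagonal'_mulVec_apply (fun j : I => P.Gwv j),
    ← blockDiagonal'_mulVec_apply (fun j : I => P.Gwa j)]
  exact congrFun h2 ⟨j, l⟩

/-- The transform of the open-loop output caused by the attack with transform `α`. -/
noncomputable def outputTransform (P : NetworkedSystem N) (I : Finset (Fin N))
    (α : (Σ j : I, Fin (P.na j)) → RatFunc ℝ) (j : I) : Fin (P.ny j) → RatFunc ℝ :=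
  (P.Gyv j).mulVec (fun l => P.inflow I α ⟨j, l⟩) + (P.Gya j).mulVec (fun l => α ⟨j, l⟩)

/-- With zero reference and `x̂ = χ̂`, the term `-E χ̂` cancels `E x̂`, so `v̂ = ŵ = 0` solves the
observer network. Each `η` then depends on its own output only, through the inverse of `openLoop`.
All transforms are rational multiples of one nonzero operator, so a signal vanishes exactly when its
rational vector does. -/
theorem exists_trajectories (hI : IsUnit (P.loop I))
    {K : StateSpace (Σ i : I, Fin (P.nw i)) (Σ i : I, Fin (P.nv i))} (hK : K.transfer = P.LSub I)
    {i : I} {k : ℕ} (F : StateSpace (Fin (P.ny i)) (Fin k))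
    (α : (Σ j : I, Fin (P.na j)) → RatFunc ℝ) :
    ∃ r a x v w y xh χh vh wh yh, P.IsTrajectory I r a x v w y ∧
      P.IsObserverTrajectory H I r y xh χh vh wh yh ∧
      ∃ ε : ℝ → Fin k → ℝ, IsResponse F.transfer (fun t => y i t - yh i t) ε ∧
        (IsZeroSignal (a i) ↔ (fun l => α ⟨i, l⟩) = 0) ∧
        (IsZeroSignal ε ↔
          (F.transfer * (P.openLoop H i)⁻¹).mulVec (P.outputTransform I α i) = 0) := by
  obtain ⟨ω, hω, hωj⟩ := exists_outflow hI α
  let ν := P.inflow I α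
  let ξ : ∀ j : I, Fin (P.nx j) → RatFunc ℝ := fun j =>
    (Matrix.scalar _ RatFunc.X - (P.A j).map RatFunc.C)⁻¹.mulVec
      (((P.U j).map RatFunc.C).mulVec (fun l => ν ⟨j, l⟩) +
        ((P.X j).map RatFunc.C).mulVec (fun l => α ⟨j, l⟩))
  let η : ∀ j : I, Fin (P.ny j) → RatFunc ℝ := fun j =>
    (P.openLoop H j)⁻¹.mulVec (P.outputTransform I α j)
  let χ : ∀ j : I, Fin (P.nx j) → RatFunc ℝ := fun j =>
    (Matrix.scalar _ RatFunc.X - (P.A j).map RatFunc.C)⁻¹.mulVec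
      (((H j).map RatFunc.C).mulVec (η j))
  let ζK := (Matrix.scalar _ RatFunc.X - K.A.map RatFunc.C)⁻¹.mulVec
    ((K.B.map RatFunc.C).mulVec ω)
  let ζF := (Matrix.scalar _ RatFunc.X - F.A.map RatFunc.C)⁻¹.mulVec
    ((F.B.map RatFunc.C).mulVec (η i))
  -- One power of `s⁻¹` makes all these transforms, including the states of `K` and `F`, continuous
  -- signals.
  obtain ⟨κ, ⟨fα, eα⟩, ⟨fν, eν⟩, ⟨fω, eω⟩, hξ, hχ, ⟨fK, eK⟩, ⟨fF, eF⟩, ⟨fε, eε⟩⟩ :=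
    ((eventually_exists_embed_eq α).and <| (eventually_exists_embed_eq ν).and <|
      (eventually_exists_embed_eq ω).and <|
      (eventually_all.2 fun j => eventually_exists_embed_eq (ξ j)).and <|
      (eventually_all.2 fun j => eventually_exists_embed_eq (χ j)).and <|
      (eventually_exists_embed_eq ζK).and <| (eventually_exists_embed_eq ζF).and
      (eventually_exists_embed_eq (F.transfer.mulVec (η i)))).exists
  choose fξ eξ using hξ
  choose fχ eχ using hχ
  set e : OperatorSpace := ((RatFunc.X : RatFunc ℝ)⁻¹ ^ κ) • embed 1
  have he : e ≠ 0 := by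
    refine smul_ne_zero (pow_ne_zero _ (inv_ne_zero RatFunc.X_ne_zero)) fun h => ?_
    rw [← embed_zero] at h
    exact one_ne_zero (embed_injective h)
  let a : ∀ j : I, ℝ → Fin (P.na j) → ℝ := fun j => vecExtend fun l => fα ⟨j, l⟩
  let v : ∀ j : I, ℝ → Fin (P.nv j) → ℝ := fun j => vecExtend fun l => fν ⟨j, l⟩
  let w : ∀ j : I, ℝ → Fin (P.nw j) → ℝ := fun j => vecExtend fun l => fω ⟨j, l⟩
  let x : ∀ j : I, ℝ → Fin (P.nx j) → ℝ := fun j => vecExtend (fξ j)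
  let c : ∀ j : I, ℝ → Fin (P.nx j) → ℝ := fun j => vecExtend (fχ j)
  let y : ∀ j : I, ℝ → Fin (P.ny j) → ℝ := fun j t =>
    (P.C j).mulVec (x j t) + (P.V j).mulVec (v j t) + (P.Y j).mulVec (a j t)
  let yh : ∀ j : I, ℝ → Fin (P.ny j) → ℝ := fun j t => (P.C j).mulVec (c j t)
  have sa : ∀ j, IsSignal (a j) := fun j => isSignal_vecExtend _
  have sv : ∀ j, IsSignal (v j) := fun j => isSignal_vecExtend _
  have sw : ∀ j, IsSignal (w j) := fun j => isSignal_vecExtend _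
  have sx : ∀ j, IsSignal (x j) := fun j => isSignal_vecExtend _
  have sc : ∀ j, IsSignal (c j) := fun j => isSignal_vecExtend _
  have sy : ∀ j, IsSignal (y j) := fun j =>
    (((sx j).mulVec (P.C j)).add ((sv j).mulVec (P.V j))).add ((sa j).mulVec (P.Y j))
  have syh : ∀ j, IsSignal (yh j) := fun j => (sc j).mulVec (P.C j)
  have oa : ∀ j, vecOperator (a j) = tensor (fun l => α ⟨j, l⟩) e := fun j => by
    rw [vecOperator_vecExtend]
    exact funext fun l => congrFun eα ⟨j, l⟩
  have ov : ∀ j, vecOperator (v j) = tensor (fun l => ν ⟨j, l⟩) e := fun j => by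
    rw [vecOperator_vecExtend]
    exact funext fun l => congrFun eν ⟨j, l⟩
  have ow : ∀ j, vecOperator (w j) = tensor (fun l => ω ⟨j, l⟩) e := fun j => by
    rw [vecOperator_vecExtend]
    exact funext fun l => congrFun eω ⟨j, l⟩
  have ox : ∀ j, vecOperator (x j) = tensor (ξ j) e := fun j => by
    rw [vecOperator_vecExtend, eξ]
  have oc : ∀ j, vecOperator (c j) = tensor (χ j) e := fun j => by
    rw [vecOperator_vecExtend, eχ]
  have oy : ∀ j, vecOperator (y j) = tensor (P.outputTransform I α j) e := fun j => by
    rw [vecOperator_add (((sx j).mulVec (P.C j)).add ((sv j).mulVec (P.V j)))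
        ((sa j).mulVec (P.Y j)), vecOperator_add ((sx j).mulVec (P.C j)) ((sv j).mulVec (P.V j)),
      vecOperator_mulVec (sx j), vecOperator_mulVec (sv j), vecOperator_mulVec (sa j), ox, ov, oa,
      act_tensor, act_tensor, act_tensor, tensor_add, tensor_add, outputTransform, Gyv, Gya,
      transferMatrix_mulVec, transferMatrix_mulVec]
    congr 1
    simp only [ξ, Matrix.mulVec_add]
    abel
  have hη : ∀ j, P.outputTransform I α j = ((P.C j).map RatFunc.C).mulVec (χ j) + η j := fun j => by
    have h1 : (1 : Matrix (Fin (P.ny j)) (Fin (P.ny j)) ℝ).map RatFunc.C = 1 :=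
      Matrix.map_one _ (map_zero _) (map_one _)
    have h2 : (P.openLoop H j).mulVec (η j) = P.outputTransform I α j := by
      rw [Matrix.mulVec_mulVec, Matrix.mul_nonsing_inv _
        ((Matrix.isUnit_iff_isUnit_det _).1 (P.isUnit_openLoop H j)), Matrix.one_mulVec]
    rw [← h2, openLoop, transferMatrix_mulVec, h1, Matrix.one_mulVec]
  have sη : ∀ j, IsSignal fun t => y j t - yh j t := fun j => (sy j).sub (syh j)
  have oη : ∀ j, vecOperator (fun t => y j t - yh j t) = tensor (η j) e := fun j => by
    rw [vecOperator_sub (sy j) (syh j), oy, vecOperator_mulVec (sc j), oc, act_tensor, tensor_sub,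
      hη, add_sub_cancel_left]
  have tc : ∀ j : I, IsStateTrajectory (P.A j) (fun t => (H j).mulVec (y j t - yh j t)) (c j) := by
    intro j
    refine isStateTrajectory_vecExtend ((sη j).mulVec (H j)) ?_
    rw [oc, vecOperator_mulVec (sη j), oη, act_tensor, act_tensor, tensor_add, smul_tensor,
      X_smul_resolvent_mulVec]
  -- The signal `c` serves both as observer state and as rectifier state.
  refine ⟨fun _ _ => 0, a, x, v, w, y, c, c, fun _ _ => 0, fun _ _ => 0, yh,
    ⟨fun _ => isSignal_zero, sa, sv, sw, fun j => ?_, fun j => ?_, fun j => ?_, ?_⟩,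
    ⟨fun _ => isSignal_zero, fun _ => isSignal_zero, fun j => ?_, tc, fun j => ?_, fun j => ?_, ?_⟩,
    vecExtend fε, ?_, ?_, ?_⟩
  · simp only [Matrix.mulVec_zero, zero_add]
    refine isStateTrajectory_vecExtend (((sv j).mulVec (P.U j)).add ((sa j).mulVec (P.X j))) ?_
    rw [ox, vecOperator_add ((sv j).mulVec (P.U j)) ((sa j).mulVec (P.X j)),
      vecOperator_mulVec (sv j), vecOperator_mulVec (sa j), ov, oa, act_tensor, act_tensor,
      act_tensor, tensor_add, tensor_add, smul_tensor, X_smul_resolvent_mulVec]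
  · exact ae_of_all _ fun t => by simp [y]
  · simp only [Matrix.mulVec_zero, add_zero]
    refine ae_eq_of_vecOperator_eq (sw j) ((((sx j).mulVec (P.E j)).add
      ((sv j).mulVec (P.W j))).add ((sa j).mulVec (P.Z j))) ?_
    rw [ow, hωj, vecOperator_add (((sx j).mulVec (P.E j)).add ((sv j).mulVec (P.W j)))
        ((sa j).mulVec (P.Z j)), vecOperator_add ((sx j).mulVec (P.E j)) ((sv j).mulVec (P.W j)),
      vecOperator_mulVec (sx j), vecOperator_mulVec (sv j), vecOperator_mulVec (sa j), ox, ov, oa,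
      act_tensor, act_tensor, act_tensor, tensor_add, tensor_add, Gwv, Gwa,
      transferMatrix_mulVec, transferMatrix_mulVec]
    congr 1
    simp only [ξ, ν, Matrix.mulVec_add]
    abel
  · rw [← hK]
    refine isResponse_of_tensor K (isSignal_stack sw) (isSignal_stack sv) (g := ω) (e := e) ?_ eK ?_
    · exact funext fun q => congrFun (ow q.1) q.2
    · rw [hK, hω]
      exact funext fun q => congrFun (ov q.1) q.2
  · simpa using tc j
  · exact ae_of_all _ fun t => by simp [yh]
  · exact ae_of_all _ fun t => by simp
  · rw [← hK]
    exact isResponse_zero K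
  · refine isResponse_of_tensor F (sη i) (isSignal_vecExtend fε) (oη i) eF ?_
    rw [vecOperator_vecExtend, eε]
  · rw [← vecOperator_eq_zero_iff (sa i), oa, tensor_eq_zero_iff he]
  · rw [← vecOperator_eq_zero_iff (isSignal_vecExtend fε), vecOperator_vecExtend, eε,
      tensor_eq_zero_iff he, ← Matrix.mulVec_mulVec]

theorem Isolates.localRankCondition {i : I} {k : ℕ}
    {S : Matrix (Fin k) (Fin (P.ny i)) (RatFunc ℝ)} (hS : P.Isolates H I i S)
    (hproper : IsProper S) (hI : IsUnit (P.loop I))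
    {K : StateSpace (Σ i : I, Fin (P.nw i)) (Σ i : I, Fin (P.nv i))} (hK : K.transfer = P.LSub I)
    (hT : IsRightInvertible (P.Tva I i)) : P.LocalRankCondition i := by
  obtain ⟨F, rfl⟩ := hproper.exists_realization
  set T := F.transfer * (P.openLoop H i)⁻¹
  -- Isolation, stated for signals, becomes a statement about arbitrary rational vectors.
  have key : ∀ α, T.mulVec (P.outputTransform I α i) = 0 ↔ (fun l => α ⟨i, l⟩) = 0 := by
    intro α
    obtain ⟨r, a, x, v, w, y, xh, χh, vh, wh, yh, h, ho, ε, hε, ha, hεz⟩ :=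
      exists_trajectories H hI hK F α
    rw [← ha, ← hεz, ← not_iff_not]
    exact hS r a x v w y xh χh vh wh yh h ho ε hε
  obtain ⟨R, hR⟩ := hT
  have hTv : T * P.Gyv i = 0 := by
    have h0 : T * P.Gyv i * P.Tva I i = 0 := by
      refine Matrix.ext_of_mulVec_single fun q => ?_
      rw [Matrix.zero_mulVec]
      -- An attack in a single channel of another subsystem reads off one column of `T G_yv T_va`.
      let α : (Σ j : I, Fin (P.na j)) → RatFunc ℝ := Pi.single q.1 1
      have hα : (fun l => α ⟨i, l⟩) = 0 := by
        ext l
        refine Pi.single_eq_of_ne (fun h => q.2 ?_) _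
        rw [← h]
      have hν : (fun l => P.inflow I α ⟨i, l⟩) = (P.Tva I i).mulVec (Pi.single q 1) := by
        ext l
        simp [inflow, α, Tva]
      have := (key α).2 hα
      rwa [outputTransform, hα, hν, Matrix.mulVec_zero, add_zero, Matrix.mulVec_mulVec,
        Matrix.mulVec_mulVec] at this
    rw [← Matrix.mul_one (T * P.Gyv i), ← hR, ← Matrix.mul_assoc, h0, Matrix.zero_mul]
  refine rank_fromCols_of_mul T hTv fun u hu => ?_
  -- Only subsystem `i` is attacked. The inflow this causes at `i` through the network is harmless
  -- because `T G_yv = 0`.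
  let α : (Σ j : I, Fin (P.na j)) → RatFunc ℝ := fun q =>
    if h : q.1 = i then u (Fin.cast (by rw [h]) q.2) else 0
  have hα : (fun l => α ⟨i, l⟩) = u := funext fun l => dif_pos rfl
  rw [← hα]
  refine (key α).1 ?_
  rw [outputTransform, hα, Matrix.mulVec_add, Matrix.mulVec_mulVec, hTv, Matrix.zero_mulVec,
    zero_add, Matrix.mulVec_mulVec, hu]

end NetworkedSystem

theorem theorem2 {N : ℕ} (P : NetworkedSystem N) (J : Set (Finset (Fin N)))
    (hwell : ∀ I ∈ J, P.WellPosed I)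
    (hstab : ∀ I ∈ J, P.InternallyStable I)
    (hdet : ∀ I ∈ J, ¬ ∃ a, P.IsUndetectable I a)
    (H : ∀ i, Matrix (Fin (P.nx i)) (Fin (P.ny i)) ℝ)
    (hH : ∀ i, IsHurwitz (P.A i - H i * P.C i))
    (i : Fin N) :
    (P.LocalRankCondition i →
      ∃ (k : ℕ) (S : Matrix (Fin k) (Fin (P.ny i)) (RatFunc ℝ)), IsStableTransfer S ∧
        ∀ I ∈ J, ∀ hi : i ∈ I, P.Isolates H I ⟨i, hi⟩ S) ∧
    (∀ I ∈ J, ∀ hi : i ∈ I, IsRightInvertible (P.Tva I ⟨i, hi⟩) →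
      (∃ (k : ℕ) (S : Matrix (Fin k) (Fin (P.ny i)) (RatFunc ℝ)), IsStableTransfer S ∧
        P.Isolates H I ⟨i, hi⟩ S) →
      P.LocalRankCondition i) := by
  refine ⟨fun h => ?_, fun I hIJ hi hT ⟨k, S, hstable, hS⟩ => ?_⟩
  · obtain ⟨k, S, hstable, hS⟩ := NetworkedSystem.exists_isolating_filter h H
    exact ⟨k, S, hstable, fun I _ hi => hS I hi⟩
  -- The constructed trajectories need a realization of `L_I`, and internal stability carries one.
  · obtain ⟨K, hK, -⟩ := hstab I hIJ
    exact hS.localRankCondition H hstable.1 (hwell I hIJ).1 hK hT
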